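/- Let $m>p>0$ and let $G:(\mathbb R^m,0)\to(\mathbb R^p,0)$ be a non-constant real analytic map germ. Write $B^k_t$ for the open ball of radius $t$ centred at $0\in\mathbb R^k$, $V_G=G^{-1}(0)$, and $\operatorname{Sing}G$ for the set of points where $dG$ is not surjective. Suppose that $G$ is *nice*: for all sufficiently small $\varepsilon,\varepsilon'>0$ the sets $G(B^m_\varepsilon)$ and $G(B^m_{\varepsilon'})$ have the same germ at $0\in\mathbb R^p$, and so do $G(B^m_\varepsilon\cap\operatorname{Sing}G)$ and $G(B^m_{\varepsilon'}\cap\operatorname{Sing}G)$. Thus $\operatorname{Im}G$ and $G(\operatorname{Sing}G)$ are well-defined set germs, and so is the discriminant $$\operatorname{Disc}G:=\overline{G(\operatorname{Sing}G)}\cup\bigl(\overline{\operatorname{Im}G}\setminus\operatorname{int}(\operatorname{Im}G)\bigr),$$ represented near $0$ by the corresponding set for the restriction $G_{|B^m_r}$, for any sufficiently small $r>0$. Let $M(G)$ be the set of points $x$ where the fibre of $G$ through $x$ is not transverse to the sphere through $x$ centred at $0$, that is, where the differential of $x\mapsto(\|x\|^2,G(x))$ is not surjective. Suppose that, as set germs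 at $0$, $$\overline{M(G)\setminus G^{-1}(\operatorname{Disc}G)}\cap V_G\subseteq\{0\}.$$ Then $G$ has a Milnor-Hamm fibration: for every sufficiently small $\varepsilon>0$ and every $\eta>0$ sufficiently small with respect to $\varepsilon$, the restriction $$G_|:B^m_\varepsilon\cap G^{-1}(B^p_\eta\setminus\operatorname{Disc}G)\to B^p_\eta\setminus\operatorname{Disc}G$$ is a locally trivial $C^\infty$-fibration (with possibly empty fibre) over each connected component of $B^p_\eta\setminus\operatorname{Disc}G$. Moreover it is independent of $\varepsilon$ and $\eta$ up to diffeomorphisms: for all sufficiently small $\varepsilon>0$, all $0<\varepsilon'<\varepsilon$ and all sufficiently small $\eta'>0$ (depending on $\varepsilon,\varepsilon'$), there is a $C^\infty$-diffeomorphism $$B^m_\varepsilon\cap G^{-1}(B^p_{\eta'}\setminus\operatorname{Disc}G)\cong B^m_{\varepsilon'}\cap G^{-1}(B^p_{\eta'}\setminus\operatorname{Disc}G)$$ commuting with $G$. -/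

import Mathlib

open Set Filter Topology Metric
open scoped ContDiff

namespace MilnorHamm

section Smooth

variable {E F B : Type*} [NormedAddCommGroup E] [NormedSpace ℝ E]
  [NormedAddCommGroup F] [NormedSpace ℝ F]

/-- A map `f` is smooth (C^∞) on an arbitrary subset `X` of a normed space if, near each point
of `X`, it agrees on `X` with a C^∞ map defined on an open set of the ambient space. -/
def SmoothOnSet (f : E → F) (X : Set E) : Prop :=
  ∀ x ∈ X, ∃ U : Set E, IsOpen U ∧ x ∈ U ∧
    ∃ g : E → F, ContDiffOn ℝ ∞ g U ∧ EqOn f g (U ∩ X)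

/-- The subsets `X` and `Y`, mapped to `B` by `π` and `π'`, are diffeomorphic over `B`: there are
mutually inverse smooth maps between `X` and `Y` that commute with the maps to `B`. -/
def DiffeoOver (X : Set E) (π : E → B) (Y : Set F) (π' : F → B) : Prop :=
  ∃ (φ : E → F) (ψ : F → E),
    MapsTo φ X Y ∧ MapsTo ψ Y X ∧ LeftInvOn ψ φ X ∧ RightInvOn ψ φ Y ∧
    SmoothOnSet φ X ∧ SmoothOnSet ψ Y ∧ ∀ x ∈ X, π' (φ x) = π x

/-- `G` restricted to `X ∩ G⁻¹(C)` is a locally trivial C^∞-fibration over the open set `C`, with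
one fibre `F` for all of `C`: every point of `C` has an open neighbourhood `W ⊆ C` such that
`X ∩ G⁻¹(W)` is diffeomorphic to `W × F` over `W`. The typical fibre is taken as a subset of the
source space; for nonempty `C` it is diffeomorphic to `X ∩ G⁻¹(y)` for each `y ∈ C`. It may be
empty. -/
def IsLocallyTrivialOver (G : E → F) (X : Set E) (C : Set F) : Prop :=
  ∃ T : Set E, ∀ y ∈ C, ∃ W : Set F, IsOpen W ∧ y ∈ W ∧ W ⊆ C ∧
    DiffeoOver (X ∩ G ⁻¹' W) G (W ×ˢ T) (Prod.fst : F × E → F)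

end Smooth

section Germs

variable {m p : ℕ}

/-- The singular locus: the points at which the differential of `G` is not surjective. -/
def sing (G : EuclideanSpace ℝ (Fin m) → EuclideanSpace ℝ (Fin p)) :
    Set (EuclideanSpace ℝ (Fin m)) :=
  {x | ¬ Function.Surjective (fderiv ℝ G x)}

/-- The image of `K` under `G` is a well-defined set germ at `0`: the germs at `0` of
`G(B_ε ∩ K)` and `G(B_ε' ∩ K)` are equal for all small radii `ε`, `ε'`. -/
def ImageIsGerm (G : EuclideanSpace ℝ (Fin m) → EuclideanSpace ℝ (Fin p))
    (K : Set (EuclideanSpace ℝ (Fin m))) : Prop :=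
  ∃ r₀ > 0, ∀ ε ∈ Ioo 0 r₀, ∀ ε' ∈ Ioo 0 r₀,
    (G '' (ball 0 ε ∩ K) : Set (EuclideanSpace ℝ (Fin p))) =ᶠ[𝓝 0] (G '' (ball 0 ε' ∩ K))

/-- `G` is a nice map germ: its image and the image of its singular locus are well-defined set
germs at `0`. -/
def IsNice (G : EuclideanSpace ℝ (Fin m) → EuclideanSpace ℝ (Fin p)) : Prop :=
  ImageIsGerm G univ ∧ ImageIsGerm G (sing G)

/-- The discriminant of the restriction of `G` to the ball of radius `r`: the closure of the image
of the singular locus, together with the boundary (closure minus interior) of the image. If `G` is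
nice then, for all small `r`, these sets have the same germ at `0`: the discriminant of the germ. -/
def disc (G : EuclideanSpace ℝ (Fin m) → EuclideanSpace ℝ (Fin p)) (r : ℝ) :
    Set (EuclideanSpace ℝ (Fin p)) :=
  closure (G '' (ball 0 r ∩ sing G)) ∪ frontier (G '' ball 0 r)

/-- The fibre of `G` through `x` is, at `x`, transverse to the sphere through `x` centred at `0`:
`x ≠ 0`, the map `G` is submersive at `x`, and the tangent space `ker dG_x` of the fibre together
with the tangent space `x^⊥` of the sphere spans the whole space. -/
def FibreTransverseSphere (G : EuclideanSpace ℝ (Fin m) → EuclideanSpace ℝ (Fin p))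
    (x : EuclideanSpace ℝ (Fin m)) : Prop :=
  x ≠ 0 ∧ Function.Surjective (fderiv ℝ G x) ∧
    LinearMap.ker (fderiv ℝ G x).toLinearMap ⊔ (Submodule.span ℝ {x})ᗮ = ⊤

/-- The Milnor set `M(G)`: the points where the fibres of `G` are not transverse to the spheres
centred at the origin. -/
def milnorSet (G : EuclideanSpace ℝ (Fin m) → EuclideanSpace ℝ (Fin p)) :
    Set (EuclideanSpace ℝ (Fin m)) :=
  {x | ¬ FibreTransverseSphere G x}

/-- The condition that the closure of `M(G) \ G⁻¹(Disc G)` meets `V_G = G⁻¹(0)` at most at the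
origin, as an inclusion of set germs at the origin. -/
def MilnorCondition (G : EuclideanSpace ℝ (Fin m) → EuclideanSpace ℝ (Fin p)) : Prop :=
  ∀ᶠ r in 𝓝[>] (0 : ℝ), ∀ᶠ x in 𝓝 (0 : EuclideanSpace ℝ (Fin m)),
    x ∈ closure (milnorSet G \ G ⁻¹' disc G r) ∩ G ⁻¹' {0} → x = 0

/-- The total space `B_ε ∩ G⁻¹(B_η \ D)`. -/
def tube (G : EuclideanSpace ℝ (Fin m) → EuclideanSpace ℝ (Fin p))
    (D : Set (EuclideanSpace ℝ (Fin p))) (ε η : ℝ) : Set (EuclideanSpace ℝ (Fin m)) :=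
  ball 0 ε ∩ G ⁻¹' (ball 0 η \ D)

/-- `G` has a Milnor-Hamm fibration. For every representative `disc G r` of the discriminant (`r`
small), every small `ε`, and every `η` that is small with respect to `ε`, the restriction
`B_ε ∩ G⁻¹(B_η \ Disc G) → B_η \ Disc G` is a locally trivial C^∞-fibration over each connected
component of `B_η \ Disc G`. It is independent of the choices: for `ε' < ε` and small `η'`, the
fibrations with radii `(ε, η')` and `(ε', η')` are diffeomorphic over `B_η' \ Disc G` (and, for
fixed `ε`, the fibration with a smaller `η'` is the restriction of the one with `η`). -/
def HasMilnorHammFibration (G : EuclideanSpace ℝ (Fin m) → EuclideanSpace ℝ (Fin p)) : Prop :=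
  ∃ ε₀ > 0, ∀ r ∈ Ioo 0 ε₀, ∀ ε ∈ Ioo 0 ε₀,
    (∃ η₀ ∈ Ioo 0 ε, ∀ η ∈ Ioc 0 η₀, ∀ y ∈ ball (0 : EuclideanSpace ℝ (Fin p)) η \ disc G r,
      IsLocallyTrivialOver G (tube G (disc G r) ε η)
        (connectedComponentIn (ball 0 η \ disc G r) y)) ∧
    ∀ ε' ∈ Ioo 0 ε, ∃ η₁ > 0, ∀ η' ∈ Ioc 0 η₁,
      DiffeoOver (tube G (disc G r) ε η') G (tube G (disc G r) ε' η') G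

end Germs

end MilnorHamm

namespace MilnorHamm

universe u

-- Smoothness of composition operators on Banach spaces of paths.

section CompositionOperator

variable {E F V : Type u} [NormedAddCommGroup E] [NormedSpace ℝ E]
  [NormedAddCommGroup F] [NormedSpace ℝ F] [NormedAddCommGroup V] [NormedSpace ℝ V]
  {I : Type*} [TopologicalSpace I] [CompactSpace I]

-- This is Ehresmann's argument, with the radius of the ball treated as a variable. In the cone `‖x‖
-- ≤ s` of pairs `(x, s)`, consider `H (x, s) = (G x, s)` over `U × (a, b)`, where `U` is a small
-- ball minus the discriminant. Since closed balls are compact, `H` restricted to the cone is proper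
-- over this set. If `G` is submersive there, with fibres transverse to the boundary `‖x‖ = s`, then
-- vectors lift smoothly along `H` to fields tangent to the boundary, and their flows transport
-- points of the cone over segments of the base. Moving `G x` at fixed `s` trivializes `G` locally;
-- moving `s` at fixed `G x` compares balls of different radii.
--
-- Regularity comes from `exists_regular_radius`. A singular point has its value in the
-- discriminant, because niceness makes the image of the singular locus independent of the ball.
-- Transversality on a compact shell `a ≤ ‖x‖ ≤ b` over a small ball of the base follows from the
-- Milnor condition near `V_G`, and from compactness.
--
-- The lift (`isLiftingField_coneLift`) is an explicit formula `P Aᵀ (A P Aᵀ)⁻¹` plus a radial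
-- correction, so no partition of unity is needed. Along it, `ρ = s² - ‖x‖²` satisfies a linear
-- homogeneous equation; hence its sign is preserved, and open balls go to open balls.
--
-- Smooth dependence of flows on initial point and velocity (`exists_smooth_flow`) follows from the
-- implicit function theorem applied to the integral equation in `C([0,1], E)`. Finally, the
-- diffeomorphism type of the fibre is locally constant, so each connected component has one typical
-- fibre.

/-- Pointwise application of a continuous family of operators to a continuous map. -/
noncomputable def pointwiseApply (I : Type*) [TopologicalSpace I] [CompactSpace I]
    (E F : Type*) [NormedAddCommGroup E] [NormedSpace ℝ E]
    [NormedAddCommGroup F] [NormedSpace ℝ F] :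
    C(I, E →L[ℝ] F) →L[ℝ] C(I, E) →L[ℝ] C(I, F) :=
  LinearMap.mkContinuous₂
    (LinearMap.mk₂ ℝ (fun (A : C(I, E →L[ℝ] F)) (c : C(I, E)) =>
      (⟨fun t => A t (c t), by fun_prop⟩ : C(I, F)))
      (by intros; ext; simp) (by intros; ext; simp) (by intros; ext; simp) (by intros; ext; simp))
    1 (by
      intro A c
      rw [one_mul, ContinuousMap.norm_le _ (by positivity)]
      intro t
      exact ((A t).le_opNorm _).trans (mul_le_mul (A.norm_coe_le_norm t) (c.norm_coe_le_norm t)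
        (norm_nonneg _) (norm_nonneg A)))

@[simp] lemma pointwiseApply_apply (A : C(I, E →L[ℝ] F)) (c : C(I, E)) (t : I) :
    pointwiseApply I E F A c t = A t (c t) := rfl

lemma norm_pointwiseApply_le (A : C(I, E →L[ℝ] F)) (c : C(I, E)) :
    ‖pointwiseApply I E F A c‖ ≤ ‖A‖ * ‖c‖ := by
  rw [ContinuousMap.norm_le _ (mul_nonneg (norm_nonneg A) (norm_nonneg c))]
  intro t
  exact ((A t).le_opNorm _).trans (mul_le_mul (A.norm_coe_le_norm t) (c.norm_coe_le_norm t)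
    (norm_nonneg _) (norm_nonneg A))

lemma isBoundedBilinearMap_pointwiseApply :
    IsBoundedBilinearMap ℝ (fun q : C(I, E →L[ℝ] F) × C(I, E) => pointwiseApply I E F q.1 q.2) where
  add_left _ _ _ := by ext; simp
  smul_left _ _ _ := by ext; simp
  add_right _ _ _ := by ext; simp
  smul_right _ _ _ := by ext; simp
  bound := ⟨1, one_pos, fun A c => by
    rw [one_mul]
    exact norm_pointwiseApply_le A c⟩

lemma contDiff_pointwiseApply {W : Type*} [NormedAddCommGroup W] [NormedSpace ℝ W]
    {A : W → C(I, E →L[ℝ] F)} {c : W → C(I, E)} (hA : ContDiff ℝ ∞ A) (hc : ContDiff ℝ ∞ c) :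
    ContDiff ℝ ∞ (fun w => pointwiseApply I E F (A w) (c w)) := by
  have h : ContDiff ℝ ∞ (fun q : C(I, E →L[ℝ] F) × C(I, E) => pointwiseApply I E F q.1 q.2) :=
    isBoundedBilinearMap_pointwiseApply.contDiff
  exact h.comp (hA.prodMk hc)

/-- A map with compactly supported derivative induces a differentiable composition operator. -/
lemma hasFDerivAt_comp_left (f : C(E, F)) (f' : C(E, E →L[ℝ] F))
    (hf : ∀ x, HasFDerivAt f (f' x) x) (hc : HasCompactSupport f') (c : C(I, E)) :
    HasFDerivAt (fun c : C(I, E) => f.comp c) (pointwiseApply I E F (f'.comp c)) c := by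
  -- Uniform continuity makes the mean value estimate below uniform in `t`, which the sup norm
  -- requires.
  have hu : UniformContinuous f' := hc.uniformContinuous_of_continuous f'.continuous
  rw [hasFDerivAt_iff_isLittleO_nhds_zero, Asymptotics.isLittleO_iff]
  intro ε hε
  obtain ⟨δ, hδ, hd⟩ := Metric.uniformContinuous_iff.1 hu ε hε
  filter_upwards [Metric.ball_mem_nhds (0 : C(I, E)) hδ] with h hh
  rw [mem_ball_zero_iff] at hh
  rw [ContinuousMap.norm_le _ (by positivity)]
  intro t
  have hht : ‖h t‖ ≤ ‖h‖ := h.norm_coe_le_norm t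
  have key := (convex_ball (c t) δ).norm_image_sub_le_of_norm_hasFDerivWithin_le'
    (f := f) (f' := f') (φ := f' (c t)) (C := ε) (x := c t) (y := c t + h t)
    (fun x _ => (hf x).hasFDerivWithinAt)
    (fun x hx => by rw [← dist_eq_norm]; exact (hd hx).le)
    (mem_ball_self hδ) (by simpa using hht.trans_lt hh)
  simp only [add_sub_cancel_left] at key
  refine le_trans ?_ (key.trans (by gcongr))
  simp

/-- The derivative is again a composition operator, that of `fderiv ℝ f`, followed by a bounded
linear map. The induction therefore changes the target to `E →L[ℝ] F`; this is why `F` is quantified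
inside and all spaces share one universe. -/
lemma contDiff_comp_left_nat (n : ℕ) : ∀ {F : Type u} [NormedAddCommGroup F] [NormedSpace ℝ F]
    (f : C(E, F)), ContDiff ℝ ∞ f → HasCompactSupport f →
    ContDiff ℝ n (fun c : C(I, E) => f.comp c) := by
  induction n with
  | zero =>
    intro F _ _ f _ _
    exact contDiff_zero.2 (ContinuousMap.continuous_postcomp f)
  | succ n ih =>
    intro F _ _ f hf hc
    have hf' : ContDiff ℝ ∞ (fderiv ℝ f) := hf.fderiv_right (by simp)
    push_cast
    refine contDiff_succ_iff_hasFDerivAt.2 ⟨_, ?_, hasFDerivAt_comp_left f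
      ⟨fderiv ℝ f, hf'.continuous⟩
      (fun x => (hf.differentiable (by simp) x).hasFDerivAt) (hc.fderiv (𝕜 := ℝ))⟩
    exact (pointwiseApply I E F).contDiff.comp (ih ⟨fderiv ℝ f, hf'.continuous⟩ hf'
      (hc.fderiv (𝕜 := ℝ)))

/-- The composition operator of a smooth compactly supported map is smooth. -/
lemma contDiff_comp_left (f : C(E, F)) (hf : ContDiff ℝ ∞ f) (hc : HasCompactSupport f) :
    ContDiff ℝ ∞ (fun c : C(I, E) => f.comp c) :=
  contDiff_infty.2 fun n => contDiff_comp_left_nat n f hf hc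

end CompositionOperator

-- The integration operator on paths.

section Integral

variable {E : Type*} [NormedAddCommGroup E] [NormedSpace ℝ E]

lemma continuous_IccExtend_unit {E : Type*} [TopologicalSpace E] (c : C(Icc (0 : ℝ) 1, E)) :
    Continuous (IccExtend zero_le_one c) :=
  c.continuous.Icc_extend'

/-- The integral from `0`, as a linear map on continuous maps on the unit interval. -/
noncomputable def integralLinear (E : Type*) [NormedAddCommGroup E] [NormedSpace ℝ E] :
    C(Icc (0 : ℝ) 1, E) →ₗ[ℝ] C(Icc (0 : ℝ) 1, E) where
  toFun c := ⟨fun t => ∫ s in (0 : ℝ)..t, IccExtend zero_le_one c s,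
    (intervalIntegral.continuous_primitive
      (fun _ _ => (continuous_IccExtend_unit c).intervalIntegrable _ _) _).comp
      continuous_subtype_val⟩
  map_add' c d := by
    ext t
    simpa [IccExtend] using intervalIntegral.integral_add
      ((continuous_IccExtend_unit c).intervalIntegrable (μ := MeasureTheory.volume) 0 t)
      ((continuous_IccExtend_unit d).intervalIntegrable (μ := MeasureTheory.volume) 0 t)
  map_smul' a c := by
    ext t
    simp [IccExtend]

lemma norm_integralLinear_apply_le (c : C(Icc (0 : ℝ) 1, E)) : ‖integralLinear E c‖ ≤ ‖c‖ := by
  rw [ContinuousMap.norm_le _ (norm_nonneg _)]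
  intro t
  refine (intervalIntegral.norm_integral_le_of_norm_le_const (C := ‖c‖)
    fun s _ => c.norm_coe_le_norm _).trans ?_
  rw [sub_zero, abs_of_nonneg t.2.1]
  exact mul_le_of_le_one_right (norm_nonneg _) t.2.2

/-- The integral from `0`, as an operator on continuous maps on the unit interval. -/
noncomputable def integralOp (E : Type*) [NormedAddCommGroup E] [NormedSpace ℝ E] :
    C(Icc (0 : ℝ) 1, E) →L[ℝ] C(Icc (0 : ℝ) 1, E) :=
  (integralLinear E).mkContinuous 1
    (fun c => by simpa using norm_integralLinear_apply_le c)

@[simp] lemma integralOp_apply (c : C(Icc (0 : ℝ) 1, E)) (t : Icc (0 : ℝ) 1) :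
    integralOp E c t = ∫ s in (0 : ℝ)..t, IccExtend zero_le_one c s := rfl

lemma norm_integralOp_apply_le (c : C(Icc (0 : ℝ) 1, E)) : ‖integralOp E c‖ ≤ ‖c‖ :=
  norm_integralLinear_apply_le c

end Integral

-- Existence and smoothness of flows.

section Flow

variable {E V : Type u} [NormedAddCommGroup E] [NormedSpace ℝ E]
  [NormedAddCommGroup V] [NormedSpace ℝ V]

/-- On the time interval `(-1, 2)`, the curve `γ` is an integral curve, starting at `x`, of the
field `z ↦ f z v`. -/
def IsSolution (f : E → V →L[ℝ] E) (x : E) (v : V) (γ : ℝ → E) : Prop :=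
  γ 0 = x ∧ ∀ t ∈ Ioo (-1 : ℝ) 2, HasDerivAt γ (f (γ t) v) t

lemma lipschitzWith_apply {f : E → V →L[ℝ] E} {K : NNReal} (hK : LipschitzWith K f) (v : V) :
    LipschitzWith (K * ‖v‖₊) (fun x => f x v) := by
  refine LipschitzWith.of_dist_le_mul fun x y => ?_
  rw [dist_eq_norm, dist_eq_norm, ← sub_apply]
  refine ((f x - f y).le_opNorm v).trans ?_
  have := hK.norm_sub_le x y
  push_cast
  calc _ ≤ K * ‖x - y‖ * ‖v‖ := by gcongr
    _ = _ := by ring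

lemma IsSolution.eqOn {f : E → V →L[ℝ] E} {K : NNReal} (hK : LipschitzWith K f) {x : E} {v : V}
    {γ γ' : ℝ → E} (h : IsSolution f x v γ) (h' : IsSolution f x v γ') :
    EqOn γ γ' (Ioo (-1) 2) :=
  ODE_solution_unique_of_mem_Ioo (v := fun _ z => f z v) (s := fun _ => univ) (t₀ := 0)
    (fun _ _ => (lipschitzWith_apply hK v).lipschitzOnWith) (by norm_num)
    (fun t ht => ⟨h.2 t ht, trivial⟩) (fun t ht => ⟨h'.2 t ht, trivial⟩) (h.1.trans h'.1.symm)

lemma exists_isSolution [CompleteSpace E] {f : E → V →L[ℝ] E} {K M : NNReal}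
    (hK : LipschitzWith K f) (hM : ∀ x, ‖f x‖ ≤ M) (x : E) (v : V) :
    ∃ γ, IsSolution f x v γ := by
  -- The speed is at most `M * ‖v‖` and the endpoints are at distance at most `2` from time `0`,
  -- whence the radius `M * ‖v‖ * 2`.
  have hPL : IsPicardLindelof (fun _ z => f z v) (tmin := -1) (tmax := 2)
      ⟨(0 : ℝ), by norm_num⟩ x (M * ‖v‖₊ * 2) 0 (M * ‖v‖₊) (K * ‖v‖₊) := by
    refine .of_time_independent (fun z _ => ?_) (lipschitzWith_apply hK v).lipschitzOnWith ?_
    · exact ((f z).le_opNorm v).trans (by push_cast; gcongr; exact hM z)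
    · push_cast
      norm_num
  obtain ⟨γ, h0, hγ⟩ := hPL.exists_eq_forall_mem_Icc_hasDerivWithinAt₀
  exact ⟨γ, h0, fun t ht => (hγ t (Ioo_subset_Icc_self ht)).hasDerivAt (Icc_mem_nhds ht.1 ht.2)⟩

lemma IsSolution.continuousOn {f : E → V →L[ℝ] E} {x : E} {v : V} {γ : ℝ → E}
    (h : IsSolution f x v γ) : ContinuousOn γ (Ioo (-1) 2) :=
  fun t ht => (h.2 t ht).continuousAt.continuousWithinAt

lemma Icc_subset_Ioo_unit : Icc (0 : ℝ) 1 ⊆ Ioo (-1) 2 :=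
  fun _ ht => ⟨by linarith [ht.1], by linarith [ht.2]⟩

/-- The defect of a path `c` as a solution of `c' = f c v`, `c 0 = x`. -/
noncomputable def defect (f : C(E, V →L[ℝ] E)) (q : (E × V) × C(Icc (0 : ℝ) 1, E)) :
    C(Icc (0 : ℝ) 1, E) :=
  q.2 - ContinuousMap.const _ q.1.1 -
    integralOp E (pointwiseApply _ V E (f.comp q.2) (ContinuousMap.const _ q.1.2))

/-- The solution as a path on the unit interval. -/
def IsSolution.path {f : E → V →L[ℝ] E} {x : E} {v : V} {γ : ℝ → E}
    (h : IsSolution f x v γ) : C(Icc (0 : ℝ) 1, E) :=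
  ⟨fun t => γ t, by
    exact continuousOn_iff_continuous_domRestrict.1 (h.continuousOn.mono Icc_subset_Ioo_unit)⟩

@[simp] lemma IsSolution.path_apply {f : E → V →L[ℝ] E} {x : E} {v : V} {γ : ℝ → E}
    (h : IsSolution f x v γ) (t : Icc (0 : ℝ) 1) : h.path t = γ t := rfl

lemma IsSolution.defect_eq_zero [CompleteSpace E] {f : C(E, V →L[ℝ] E)} {x : E} {v : V}
    {γ : ℝ → E} (h : IsSolution f x v γ) : defect f ((x, v), h.path) = 0 := by
  ext t
  have hsub : uIcc 0 (t : ℝ) ⊆ Icc 0 1 := by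
    rw [uIcc_of_le t.2.1]
    exact Icc_subset_Icc_right t.2.2
  have hint : ∫ s in (0 : ℝ)..t, f (γ s) v = γ t - γ 0 := by
    refine intervalIntegral.integral_eq_sub_of_hasDerivAt
      (fun s hs => h.2 s (Icc_subset_Ioo_unit (hsub hs))) (ContinuousOn.intervalIntegrable ?_)
    have := f.continuous.comp_continuousOn (h.continuousOn.mono (hsub.trans Icc_subset_Ioo_unit))
    exact this.clm_apply continuousOn_const
  have hcong : ∫ s in (0 : ℝ)..t, IccExtend zero_le_one
      (pointwiseApply _ V E (f.comp h.path) (ContinuousMap.const _ v)) s =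
      ∫ s in (0 : ℝ)..t, f (γ s) v := by
    refine intervalIntegral.integral_congr fun s hs => ?_
    simp [IccExtend_of_mem _ _ (hsub hs)]
  simp only [defect, ContinuousMap.sub_apply, ContinuousMap.const_apply, integralOp_apply,
    ContinuousMap.zero_apply]
  rw [hcong, hint, h.1]
  simp

lemma lipschitzWith_integralOp_apply {f : C(E, V →L[ℝ] E)} {K : NNReal} (hK : LipschitzWith K f)
    (v : V) : LipschitzWith (K * ‖v‖₊) (fun c : C(Icc (0 : ℝ) 1, E) =>
      integralOp E (pointwiseApply _ V E (f.comp c) (ContinuousMap.const _ v))) := by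
  refine LipschitzWith.of_dist_le_mul fun c d => ?_
  rw [dist_eq_norm, dist_eq_norm, ← map_sub]
  refine (norm_integralOp_apply_le _).trans ?_
  rw [ContinuousMap.norm_le _ (by positivity)]
  intro t
  have := (lipschitzWith_apply hK v).norm_sub_le (c t) (d t)
  simp only [ContinuousMap.sub_apply, pointwiseApply_apply, ContinuousMap.comp_apply,
    ContinuousMap.const_apply]
  exact this.trans (by gcongr; exact (c - d).norm_coe_le_norm t)

/-- The Picard operator is a contraction for `K * ‖v‖ < 1`, so it has at most one fixed path. -/
lemma path_unique {f : C(E, V →L[ℝ] E)} {K : NNReal} (hK : LipschitzWith K f) {x : E} {v : V}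
    (hv : K * ‖v‖₊ < 1) {c d : C(Icc (0 : ℝ) 1, E)}
    (hc : defect f ((x, v), c) = 0) (hd : defect f ((x, v), d) = 0) : c = d := by
  have h := (lipschitzWith_integralOp_apply hK v).dist_le_mul c d
  simp only [defect, sub_eq_zero] at hc hd
  rw [← hc, ← hd, dist_sub_right] at h
  have h1 : ((K * ‖v‖₊ : NNReal) : ℝ) < 1 := by exact_mod_cast hv
  by_contra hne
  have := dist_pos.2 hne
  nlinarith

lemma contDiff_const_path (W : Type*) [NormedAddCommGroup W] [NormedSpace ℝ W] :
    ContDiff ℝ ∞ (fun x : W => ContinuousMap.const (Icc (0 : ℝ) 1) x) :=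
  (ContinuousLinearMap.const ℝ (Icc (0 : ℝ) 1) : W →L[ℝ] _).contDiff

lemma contDiff_integralOp_apply {f : C(E, V →L[ℝ] E)} (hf : ContDiff ℝ ∞ f)
    (hc : HasCompactSupport f) : ContDiff ℝ ∞ (fun q : V × C(Icc (0 : ℝ) 1, E) =>
      integralOp E (pointwiseApply _ V E (f.comp q.2) (ContinuousMap.const _ q.1))) := by
  have h1 : ContDiff ℝ ∞ (fun q : V × C(Icc (0 : ℝ) 1, E) => f.comp q.2) :=
    (contDiff_comp_left f hf hc).comp contDiff_snd
  have h2 : ContDiff ℝ ∞ (fun q : V × C(Icc (0 : ℝ) 1, E) =>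
      ContinuousMap.const (Icc (0 : ℝ) 1) q.1) :=
    (contDiff_const_path V).comp contDiff_fst
  exact (integralOp E).contDiff.comp (contDiff_pointwiseApply h1 h2)

lemma differentiableAt_integralOp_apply {f : C(E, V →L[ℝ] E)} (hf : ContDiff ℝ ∞ f)
    (hc : HasCompactSupport f) (v : V) (c₀ : C(Icc (0 : ℝ) 1, E)) :
    DifferentiableAt ℝ (fun c : C(Icc (0 : ℝ) 1, E) =>
      integralOp E (pointwiseApply _ V E (f.comp c) (ContinuousMap.const _ v))) c₀ := by
  have h : ContDiff ℝ ∞ (fun c : C(Icc (0 : ℝ) 1, E) => (v, c)) :=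
    contDiff_const.prodMk contDiff_id
  exact ((contDiff_integralOp_apply hf hc).comp h).differentiable (by simp) c₀

lemma contDiff_defect {f : C(E, V →L[ℝ] E)} (hf : ContDiff ℝ ∞ f) (hc : HasCompactSupport f) :
    ContDiff ℝ ∞ (defect f) := by
  have h1 : ContDiff ℝ ∞ (fun q : (E × V) × C(Icc (0 : ℝ) 1, E) =>
      ContinuousMap.const (Icc (0 : ℝ) 1) q.1.1) :=
    (contDiff_const_path E).comp (contDiff_fst.comp contDiff_fst)
  have h2 : ContDiff ℝ ∞ (fun q : (E × V) × C(Icc (0 : ℝ) 1, E) => (q.1.2, q.2)) :=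
    (contDiff_snd.comp contDiff_fst).prodMk contDiff_snd
  have h3 := (contDiff_integralOp_apply hf hc).comp h2
  exact (contDiff_snd.sub h1).sub h3

/-- The partial derivative in the path is the identity minus an operator of norm at most `K * ‖v₀‖ <
1`, hence invertible by the Neumann series. -/
lemma isInvertible_fderiv_defect [CompleteSpace E] {f : C(E, V →L[ℝ] E)} (hf : ContDiff ℝ ∞ f)
    (hc : HasCompactSupport f) {K : NNReal} (hK : LipschitzWith K f) (x₀ : E) {v₀ : V}
    (hv₀ : K * ‖v₀‖₊ < 1) (c₀ : C(Icc (0 : ℝ) 1, E)) :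
    (fderiv ℝ (defect f) ((x₀, v₀), c₀) ∘L
      ContinuousLinearMap.inr ℝ (E × V) C(Icc (0 : ℝ) 1, E)).IsInvertible := by
  set T : C(Icc (0 : ℝ) 1, E) → C(Icc (0 : ℝ) 1, E) := fun c =>
      integralOp E (pointwiseApply _ V E (f.comp c) (ContinuousMap.const _ v₀)) with hT
  have hTd : DifferentiableAt ℝ T c₀ := differentiableAt_integralOp_apply hf hc v₀ c₀
  have h1 : HasFDerivAt (fun c => defect f ((x₀, v₀), c))
      (fderiv ℝ (defect f) ((x₀, v₀), c₀) ∘L ContinuousLinearMap.inr ℝ (E × V) _) c₀ :=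
    ((contDiff_defect hf hc).differentiable (by simp) _).hasFDerivAt.comp c₀
      (hasFDerivAt_prodMk_right _ _)
  have h2 : HasFDerivAt (fun c => defect f ((x₀, v₀), c))
      (ContinuousLinearMap.id ℝ _ - fderiv ℝ T c₀) c₀ :=
    ((hasFDerivAt_id c₀).sub_const (ContinuousMap.const _ x₀)).sub hTd.hasFDerivAt
  rw [h1.unique h2]
  have hn : ‖fderiv ℝ T c₀‖ < 1 :=
    (norm_fderiv_le_of_lipschitz ℝ (lipschitzWith_integralOp_apply hK v₀)).trans_lt
      (by exact_mod_cast hv₀)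
  obtain ⟨e, he⟩ := (isUnit_one_sub_of_norm_lt_one (R := C(Icc (0 : ℝ) 1, E) →L[ℝ] C(Icc (0 : ℝ) 1, E)) hn)
  exact ⟨ContinuousLinearEquiv.ofUnit e, he⟩

/-- For short times, solutions depend smoothly on the initial point and on the velocity. -/
lemma contDiffAt_solution [CompleteSpace E] [CompleteSpace V] {f : C(E, V →L[ℝ] E)}
    (hf : ContDiff ℝ ∞ f) (hc : HasCompactSupport f) {K : NNReal} (hK : LipschitzWith K f)
    {γ : E → V → ℝ → E} (hγ : ∀ x v, IsSolution f x v (γ x v)) (x₀ : E) {v₀ : V}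
    (hv₀ : K * ‖v₀‖₊ < 1) : ContDiffAt ℝ ∞ (fun q : E × V => γ q.1 q.2 1) (x₀, v₀) := by
  have hF : ContDiffAt ℝ ∞ (defect f) ((x₀, v₀), (hγ x₀ v₀).path) :=
    (contDiff_defect hf hc).contDiffAt
  have hinv := isInvertible_fderiv_defect hf hc hK x₀ hv₀ (hγ x₀ v₀).path
  have hsm := hF.contDiffAt_implicitFunction (by simp) hinv
  have hev := hF.eventually_apply_implicitFunction (by simp) hinv
  have hnear : ∀ᶠ q : E × V in 𝓝 (x₀, v₀), K * ‖q.2‖₊ < 1 := by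
    have h : Continuous (fun q : E × V => K * ‖q.2‖₊) := by fun_prop
    exact h.continuousAt.eventually_lt continuousAt_const hv₀
  have heval : ContDiff ℝ ∞ (fun c : C(Icc (0 : ℝ) 1, E) => c ⟨1, by simp⟩) :=
    IsBoundedLinearMap.contDiff
      ⟨⟨fun _ _ => rfl, fun _ _ => rfl⟩, 1, one_pos, fun c => by
        rw [one_mul]
        exact c.norm_coe_le_norm _⟩
  -- The implicit function produces zeros of the defect; by uniqueness these are the given
  -- solutions.
  refine (heval.contDiffAt.comp _ hsm).congr_of_eventuallyEq ?_
  filter_upwards [hev, hnear] with q hq hq'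
  rw [(hγ x₀ v₀).defect_eq_zero] at hq
  have := path_unique hK hq' (hγ q.1 q.2).defect_eq_zero hq
  exact congrArg (fun c : C(Icc (0 : ℝ) 1, E) => c ⟨1, by simp⟩) this

lemma IsSolution.rescale {f : E → V →L[ℝ] E} {x : E} {v : V} {γ : ℝ → E}
    (h : IsSolution f x v γ) {a b : ℝ} (ha : ∀ t ∈ Ioo (-1 : ℝ) 2, a + b * t ∈ Ioo (-1 : ℝ) 2) :
    IsSolution f (γ a) (b • v) (fun t => γ (a + b * t)) := by
  refine ⟨by simp, fun t ht => ?_⟩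
  have h1 : HasDerivAt (fun t : ℝ => a + b * t) b t := by
    simpa using ((hasDerivAt_id t).const_mul b).const_add a
  have h2 := (h.2 _ (ha t ht)).scomp t h1
  rw [← map_smul] at h2
  exact h2

/-- The flow of a compactly supported field depends smoothly on the initial point and on the
velocity. -/
theorem exists_smooth_flow [CompleteSpace E] [CompleteSpace V] {f : E → V →L[ℝ] E} (hf : ContDiff ℝ ∞ f)
    (hc : HasCompactSupport f) :
    ∃ γ : E → V → ℝ → E, (∀ x v, IsSolution f x v (γ x v)) ∧
      ContDiff ℝ ∞ (fun q : E × V => γ q.1 q.2 1) := by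
  obtain ⟨K, hK⟩ := ContDiff.lipschitzWith_of_hasCompactSupport hc hf (by simp)
  obtain ⟨M, hM⟩ := hc.exists_bound_of_continuous hf.continuous
  choose γ hγ using fun x v => exists_isSolution (M := M.toNNReal) hK
    (fun x => (hM x).trans (Real.le_coe_toNNReal M)) x v
  refine ⟨γ, hγ, contDiff_iff_contDiffAt.2 fun ⟨x₀, v₀⟩ => ?_⟩
  -- The flow with velocity `v₀` is an `N`-fold composite of time-one flows with velocity `v₀ / N`,
  -- which is small enough for `contDiffAt_solution`.
  obtain ⟨N, hN⟩ := exists_nat_gt (K * ‖v₀‖ : ℝ)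
  have hN0 : (0 : ℝ) < N := lt_of_le_of_lt (by positivity) hN
  have hsmall : ∀ x, ContDiffAt ℝ ∞ (fun q : E × V => γ q.1 q.2 1) (x, (N : ℝ)⁻¹ • v₀) := by
    intro x
    refine contDiffAt_solution (f := ⟨f, hf.continuous⟩) hf hc hK hγ x ?_
    rw [← NNReal.coe_lt_coe]
    push_cast
    rw [norm_smul, norm_inv, Real.norm_natCast]
    calc (K * ((N : ℝ)⁻¹ * ‖v₀‖) : ℝ) = K * ‖v₀‖ / N := by field_simp
      _ < 1 := (div_lt_one hN0).2 hN
  have hstep : ∀ k : ℕ, k < N → ∀ x v,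
      γ x v ((k + 1 : ℕ) / N) = γ (γ x v (k / N)) ((N : ℝ)⁻¹ • v) 1 := by
    intro k hk x v
    have hk' : (k : ℝ) + 1 ≤ N := by exact_mod_cast hk
    have hsol := (hγ x v).rescale (a := k / N) (b := (N : ℝ)⁻¹) (fun t ht => by
      have : (k : ℝ) / N + (N : ℝ)⁻¹ * t = (k + t) / N := by field_simp
      rw [this, mem_Ioo, lt_div_iff₀ hN0, div_lt_iff₀ hN0]
      have : (0 : ℝ) ≤ k := k.cast_nonneg
      have h1 := ht.1
      have h2 := ht.2
      have : (1 : ℝ) ≤ N := by linarith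
      constructor <;> linarith)
    have := hsol.eqOn hK (hγ _ _) (show (1 : ℝ) ∈ Ioo (-1) 2 by norm_num)
    rw [← this]
    push_cast
    congr 1
    field_simp
  have hall : ∀ k : ℕ, k ≤ N → ContDiffAt ℝ ∞ (fun q : E × V => γ q.1 q.2 (k / N)) (x₀, v₀) := by
    intro k
    induction k with
    | zero =>
      intro _
      have : (fun q : E × V => γ q.1 q.2 ((0 : ℕ) / N)) = Prod.fst := by
        ext q
        simpa using (hγ q.1 q.2).1
      rw [this]
      exact contDiffAt_fst
    | succ k ih =>
      intro hk
      have h1 : (fun q : E × V => γ q.1 q.2 ((k + 1 : ℕ) / N)) =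
          (fun q : E × V => γ q.1 q.2 1) ∘
            (fun q : E × V => (γ q.1 q.2 (k / N), (N : ℝ)⁻¹ • q.2)) := by
        ext q
        exact hstep k hk q.1 q.2
      rw [h1]
      exact ContDiffAt.comp _ (hsmall _)
        ((ih (Nat.le_of_succ_le hk)).prodMk (contDiffAt_snd.const_smul _))
  simpa [div_self hN0.ne'] using hall N le_rfl

end Flow

-- Transport along lifting fields.

section Transport

variable {E V : Type u} [NormedAddCommGroup E] [NormedSpace ℝ E]
  [NormedAddCommGroup V] [NormedSpace ℝ V]

lemma exists_smooth_cutoff [FiniteDimensional ℝ E] {K Ω : Set E} (hK : IsCompact K)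
    (hΩ : IsOpen Ω) (h : K ⊆ Ω) :
    ∃ χ : E → ℝ, ContDiff ℝ ∞ χ ∧ HasCompactSupport χ ∧ tsupport χ ⊆ Ω ∧
      (∀ x, χ x ∈ Icc (0 : ℝ) 1) ∧ ∀ x ∈ K, χ x = 1 := by
  obtain ⟨L, hL, hKL, hLΩ⟩ := exists_compact_between hK hΩ h
  obtain ⟨χ, h0, h1, h2⟩ := exists_contMDiffMap_zero_one_of_isClosed (n := ⊤)
    (modelWithCornersSelf ℝ E) (isOpen_interior (s := L)).isClosed_compl hK.isClosed
    (disjoint_left.2 fun x hx hx' => hx (hKL hx'))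
  have hsub : Function.support χ ⊆ L := fun x hx => by
    by_contra hxL
    exact hx (h0 fun hi => hxL (interior_subset hi))
  have hts : tsupport χ ⊆ L := closure_minimal hsub hL.isClosed
  exact ⟨χ, χ.contMDiff.contDiff, hL.of_isClosed_subset (isClosed_tsupport _) hts,
    hts.trans hLΩ, h2, fun x hx => h1 hx⟩

lemma exists_antiderivative {k : ℝ → ℝ} (hk : ContinuousOn k (Ioo (-1) 2)) :
    ∀ t ∈ Ioo (-1 : ℝ) 2, HasDerivAt (fun t => ∫ s in (0 : ℝ)..t, k s) (k t) t := by
  intro t ht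
  have hsub : uIcc 0 t ⊆ Ioo (-1) 2 :=
    ordConnected_Ioo.uIcc_subset (by norm_num) ht
  exact intervalIntegral.integral_hasDerivAt_right (hk.mono hsub).intervalIntegrable
    (hk.stronglyMeasurableAtFilter isOpen_Ioo t ht) (hk.continuousAt (isOpen_Ioo.mem_nhds ht))

lemma eq_of_hasDerivAt_zero {g : ℝ → E} (hg : ∀ t ∈ Ioo (-1 : ℝ) 2, HasDerivAt g 0 t)
    {t : ℝ} (ht : t ∈ Ioo (-1 : ℝ) 2) : g t = g 0 :=
  isOpen_Ioo.is_const_of_deriv_eq_zero isPreconnected_Ioo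
    (fun s hs => (hg s hs).differentiableAt.differentiableWithinAt)
    (fun s hs => (hg s hs).deriv) ht (by norm_num)

/-- A field `ξ` of lifts along `H` of the vectors of `V`, tangent to the zero set of `ρ`; the map
`H` restricted to `{0 ≤ ρ}` is proper over `O`. -/
structure IsLiftingField (Ω : Set E) (H : E → V) (ρ : E → ℝ) (ξ : E → V →L[ℝ] E)
    (O : Set V) : Prop where
  isOpen : IsOpen Ω
  contDiffOn : ContDiffOn ℝ ∞ ξ Ω
  differentiableAt : ∀ x ∈ Ω, DifferentiableAt ℝ H x
  lift : ∀ x ∈ Ω, ∀ v, fderiv ℝ H x (ξ x v) = v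
  differentiableAt_bound : ∀ x ∈ Ω, DifferentiableAt ℝ ρ x
  tangent : ∀ v, ∃ g : E → ℝ, ContinuousOn g Ω ∧ ∀ x ∈ Ω, fderiv ℝ ρ x (ξ x v) = ρ x * g x
  subset : ∀ x, 0 ≤ ρ x → H x ∈ O → x ∈ Ω
  proper : ∀ C ⊆ O, IsCompact C → IsCompact {x | 0 ≤ ρ x ∧ H x ∈ C}

/-- Transport from `x` to `z` along an integral curve of `ξ` with velocity `v`. -/
def Transports (H : E → V) (ρ : E → ℝ) (ξ : E → V →L[ℝ] E) (x : E) (v : V) (z : E) : Prop :=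
  ∃ γ : ℝ → E, γ 0 = x ∧ γ 1 = z ∧ ∀ t ∈ Icc (0 : ℝ) 1, HasDerivAt γ (ξ (γ t) v) t ∧
    H (γ t) = H x + t • v ∧ 0 ≤ ρ (γ t) ∧ (0 < ρ x ↔ 0 < ρ (γ t))

variable {Ω : Set E} {H : E → V} {ρ : E → ℝ} {ξ : E → V →L[ℝ] E} {O : Set V}

lemma Transports.map_eq {x z : E} {v : V} (h : Transports H ρ ξ x v z) : H z = H x + v := by
  obtain ⟨γ, -, rfl, h⟩ := h
  simpa using (h 1 (by simp)).2.1

lemma Transports.pos_iff {x z : E} {v : V} (h : Transports H ρ ξ x v z) : 0 < ρ x ↔ 0 < ρ z := by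
  obtain ⟨γ, -, rfl, h⟩ := h
  exact (h 1 (by simp)).2.2.2

lemma Transports.symm {x z : E} {v : V} (h : Transports H ρ ξ x v z) :
    Transports H ρ ξ z (-v) x := by
  have hz := h.map_eq
  have hp := h.pos_iff
  obtain ⟨γ, h0, h1, h⟩ := h
  refine ⟨fun t => γ (1 - t), by simpa using h1, by simpa using h0, fun t ht => ?_⟩
  obtain ⟨hd, hH, hn, hpos⟩ := h (1 - t) ⟨by linarith [ht.2], by linarith [ht.1]⟩
  refine ⟨?_, ?_, hn, hp.symm.trans hpos⟩
  · have h2 := hd.scomp t ((hasDerivAt_id t).const_sub 1)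
    simpa [Function.comp_def] using h2
  · rw [hH, hz]
    module

namespace IsLiftingField

/-- A compactly supported field which agrees with `ξ` on the part over a given compact set. -/
lemma exists_field [FiniteDimensional ℝ E] (h : IsLiftingField Ω H ρ ξ O) {C : Set V}
    (hC : IsCompact C) (hCO : C ⊆ O) :
    ∃ χ : E → ℝ, Continuous χ ∧ (∀ x, χ x ∈ Icc (0 : ℝ) 1) ∧ (∀ x ∉ Ω, χ x = 0) ∧
      (∀ x, 0 ≤ ρ x → H x ∈ C → χ x = 1) ∧ ContDiff ℝ ∞ (fun x => χ x • ξ x) ∧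
      HasCompactSupport (fun x => χ x • ξ x) := by
  obtain ⟨χ, hχ, hc, hs, h01, h1⟩ := exists_smooth_cutoff (h.proper C hCO hC) h.isOpen
    (fun x hx => h.subset x hx.1 (hCO hx.2))
  refine ⟨χ, hχ.continuous, h01, fun x hx => ?_, fun x h0 h2 => h1 x ⟨h0, h2⟩, ?_,
    hc.smul_right⟩
  · by_contra hne
    exact hx (hs (subset_tsupport _ hne))
  · refine contDiff_iff_contDiffAt.2 fun x => ?_
    by_cases hx : x ∈ tsupport χ
    · exact hχ.contDiffAt.smul (h.contDiffOn.contDiffAt (h.isOpen.mem_nhds (hs hx)))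
    · refine contDiffAt_const (c := 0) |>.congr_of_eventuallyEq ?_
      filter_upwards [notMem_tsupport_iff_eventuallyEq.1 hx] with y hy
      simp [hy]

/-- Along the cut-off flow, `H` moves by `(∫ χ) • v` and `ρ` is multiplied by an exponential. As `0
≤ ∫ χ ≤ t`, the curve stays over the segment and in `{0 ≤ ρ}`, where `χ = 1`; so the cutoff has no
effect. -/
lemma transports_of_isSolution (h : IsLiftingField Ω H ρ ξ O) {C : Set V} (hCO : C ⊆ O)
    {χ : E → ℝ} (hχ : Continuous χ) (h01 : ∀ x, χ x ∈ Icc (0 : ℝ) 1) (h0 : ∀ x ∉ Ω, χ x = 0)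
    (h1 : ∀ x, 0 ≤ ρ x → H x ∈ C → χ x = 1) {L : NNReal}
    (hL : LipschitzWith L (fun x => χ x • ξ x)) {x : E} {v : V} (hx : 0 ≤ ρ x)
    (hseg : ∀ t ∈ Icc (0 : ℝ) 1, H x + t • v ∈ C) {γ : ℝ → E}
    (hγ : IsSolution (fun x => χ x • ξ x) x v γ) : Transports H ρ ξ x v (γ 1) := by
  have hmem0 : (0 : ℝ) ∈ Ioo (-1 : ℝ) 2 := by norm_num
  have hxΩ : x ∈ Ω := h.subset x hx (hCO (by simpa using hseg 0 (by simp)))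
  -- Points outside `Ω` are equilibria of the cut-off field, and a solution starting in `Ω` cannot
  -- reach one.
  have hΩ : ∀ t ∈ Ioo (-1 : ℝ) 2, γ t ∈ Ω := by
    intro t ht
    by_contra hnot
    have := ODE_solution_unique_of_mem_Ioo (v := fun _ z => (χ z • ξ z) v) (s := fun _ => univ)
      (t₀ := t) (f := γ) (g := fun _ => γ t)
      (fun _ _ => (lipschitzWith_apply hL v).lipschitzOnWith) ht
      (fun s hs => ⟨hγ.2 s hs, trivial⟩)
      (fun s _ => ⟨by simpa [h0 _ hnot] using hasDerivAt_const s (γ t), trivial⟩) rfl hmem0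
    have hxt : x = γ t := hγ.1.symm.trans this
    exact hnot (hxt ▸ hxΩ)
  have hder : ∀ t ∈ Ioo (-1 : ℝ) 2, HasDerivAt γ (χ (γ t) • ξ (γ t) v) t :=
    fun t ht => hγ.2 t ht
  have hχγ : ContinuousOn (fun t => χ (γ t)) (Ioo (-1) 2) := hχ.comp_continuousOn hγ.continuousOn
  have hHγ : ∀ t ∈ Ioo (-1 : ℝ) 2, H (γ t) = H x + (∫ s in (0 : ℝ)..t, χ (γ s)) • v := by
    intro t ht
    have key := eq_of_hasDerivAt_zero
      (g := fun t => H (γ t) - (∫ s in (0 : ℝ)..t, χ (γ s)) • v) (fun s hs => by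
        have e1 := (h.differentiableAt _ (hΩ s hs)).hasFDerivAt.comp_hasDerivAt s (hder s hs)
        rw [map_smul, h.lift _ (hΩ s hs)] at e1
        have e2 := (exists_antiderivative hχγ s hs).smul_const v
        have e3 := e1.sub e2
        rw [sub_self] at e3
        exact e3) ht
    simp only [intervalIntegral.integral_same, zero_smul, sub_zero, hγ.1] at key
    rw [← key]
    abel
  obtain ⟨g, hg, htan⟩ := h.tangent v
  have hkγ : ContinuousOn (fun t => χ (γ t) * g (γ t)) (Ioo (-1) 2) :=
    hχγ.mul (hg.comp hγ.continuousOn hΩ)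
  have hργ : ∀ t ∈ Ioo (-1 : ℝ) 2,
      ρ (γ t) = ρ x * Real.exp (∫ s in (0 : ℝ)..t, χ (γ s) * g (γ s)) := by
    intro t ht
    have key := eq_of_hasDerivAt_zero
      (g := fun t => ρ (γ t) * Real.exp (-∫ s in (0 : ℝ)..t, χ (γ s) * g (γ s))) (fun s hs => by
        have e1 := (h.differentiableAt_bound _ (hΩ s hs)).hasFDerivAt.comp_hasDerivAt s (hder s hs)
        rw [map_smul, htan _ (hΩ s hs)] at e1
        have e2 := (exists_antiderivative hkγ s hs).neg.exp
        have e3 := e1.mul e2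
        rw [smul_eq_mul, Function.comp_apply, show ∀ a b c d : ℝ,
          a * (b * c) * d + b * (d * -(a * c)) = 0 by intros; ring] at e3
        exact e3) ht
    simp only [intervalIntegral.integral_same, neg_zero, Real.exp_zero, mul_one, hγ.1] at key
    rw [← key, mul_assoc, ← Real.exp_add]
    simp
  have hone : ∀ t ∈ Icc (0 : ℝ) 1, 0 ≤ ρ (γ t) ∧ χ (γ t) = 1 := by
    intro t ht
    have ht' := Icc_subset_Ioo_unit ht
    have hρ : 0 ≤ ρ (γ t) := by
      rw [hργ t ht']
      positivity
    refine ⟨hρ, h1 _ hρ ?_⟩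
    rw [hHγ t ht']
    refine hseg _ ⟨intervalIntegral.integral_nonneg ht.1 fun s _ => (h01 _).1, ?_⟩
    have := intervalIntegral.norm_integral_le_of_norm_le_const (a := 0) (b := t) (C := 1)
      (f := fun s => χ (γ s)) (fun s _ => by
        rw [Real.norm_of_nonneg (h01 _).1]
        exact (h01 _).2)
    rw [sub_zero, abs_of_nonneg ht.1, one_mul] at this
    exact (Real.le_norm_self _).trans (this.trans ht.2)
  refine ⟨γ, hγ.1, rfl, fun t ht => ⟨?_, ?_, (hone t ht).1, ?_⟩⟩
  · simpa [(hone t ht).2] using hder t (Icc_subset_Ioo_unit ht)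
  · rw [hHγ t (Icc_subset_Ioo_unit ht)]
    congr 2
    have : ∫ s in (0 : ℝ)..t, χ (γ s) = ∫ s in (0 : ℝ)..t, (1 : ℝ) := by
      refine intervalIntegral.integral_congr fun s hs => (hone s ?_).2
      rw [uIcc_of_le ht.1] at hs
      exact ⟨hs.1, hs.2.trans ht.2⟩
    simp [this]
  · rw [hργ t (Icc_subset_Ioo_unit ht)]
    exact (mul_pos_iff_of_pos_right (Real.exp_pos _)).symm

/-- Over a compact set, transport is realized by a smooth map. -/
theorem exists_transport [FiniteDimensional ℝ E] [CompleteSpace V]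
    (h : IsLiftingField Ω H ρ ξ O) {C : Set V} (hC : IsCompact C) (hCO : C ⊆ O) :
    ∃ Ψ : E → V → E, ContDiff ℝ ∞ (fun q : E × V => Ψ q.1 q.2) ∧
      ∀ x v, 0 ≤ ρ x → (∀ t ∈ Icc (0 : ℝ) 1, H x + t • v ∈ C) →
        Transports H ρ ξ x v (Ψ x v) := by
  have : CompleteSpace E := FiniteDimensional.complete ℝ E
  obtain ⟨χ, hχ, h01, h0, h1, hf, hc⟩ := h.exists_field hC hCO
  obtain ⟨L, hL⟩ := ContDiff.lipschitzWith_of_hasCompactSupport hc hf (by simp)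
  obtain ⟨γ, hγ, hsm⟩ := exists_smooth_flow hf hc
  exact ⟨fun x v => γ x v 1, hsm, fun x v hx hseg =>
    h.transports_of_isSolution hCO hχ h01 h0 h1 hL hx hseg (hγ x v)⟩

/-- Both curves solve the same Lipschitz equation, cut off around the segment. Transport thus does
not depend on the cutoff, which allows local constructions to be glued and inverses to be checked.
-/
lemma transports_unique [FiniteDimensional ℝ E] (h : IsLiftingField Ω H ρ ξ O) {x z z' : E}
    {v : V} (hseg : ∀ t ∈ Icc (0 : ℝ) 1, H x + t • v ∈ O) (hz : Transports H ρ ξ x v z)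
    (hz' : Transports H ρ ξ x v z') : z = z' := by
  have hC : IsCompact ((fun t : ℝ => H x + t • v) '' Icc 0 1) :=
    isCompact_Icc.image (by fun_prop)
  obtain ⟨χ, hχ, h01, h0, h1, hf, hc⟩ := h.exists_field hC (by
    rintro _ ⟨t, ht, rfl⟩
    exact hseg t ht)
  obtain ⟨L, hL⟩ := ContDiff.lipschitzWith_of_hasCompactSupport hc hf (by simp)
  have hder : ∀ γ : ℝ → E, (∀ t ∈ Icc (0 : ℝ) 1, HasDerivAt γ (ξ (γ t) v) t ∧
      H (γ t) = H x + t • v ∧ 0 ≤ ρ (γ t) ∧ (0 < ρ x ↔ 0 < ρ (γ t))) →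
      ∀ t ∈ Icc (0 : ℝ) 1, HasDerivAt γ ((χ (γ t) • ξ (γ t)) v) t := by
    intro γ hγ t ht
    obtain ⟨hd, hH, hn, -⟩ := hγ t ht
    rw [h1 (γ t) hn (hH ▸ mem_image_of_mem _ ht), one_smul]
    exact hd
  obtain ⟨γ, rfl, rfl, hγ⟩ := hz
  obtain ⟨γ', h0', rfl, hγ'⟩ := hz'
  rw [← h0'] at hγ'
  have hd := hder γ hγ
  have hd' := hder γ' (h0' ▸ hγ')
  exact ODE_solution_unique (v := fun _ z => (χ z • ξ z) v) (a := 0) (b := 1)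
    (fun _ => lipschitzWith_apply hL v)
    (fun t ht => (hd t ht).continuousAt.continuousWithinAt)
    (fun t ht => (hd t (Ico_subset_Icc_self ht)).hasDerivWithinAt)
    (fun t ht => (hd' t ht).continuousAt.continuousWithinAt)
    (fun t ht => (hd' t (Ico_subset_Icc_self ht)).hasDerivWithinAt) h0'.symm (by simp)

end IsLiftingField

end Transport

-- An explicit lift tangent to the spheres.

section SphericalLift

set_option linter.unusedSectionVars false

variable {E F : Type} [NormedAddCommGroup E] [InnerProductSpace ℝ E] [FiniteDimensional ℝ E]
  [NormedAddCommGroup F] [InnerProductSpace ℝ F] [FiniteDimensional ℝ F]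

/-- The operator `z ↦ s² z - ⟪x, z⟫ x`, which takes values orthogonal to `x` if `‖x‖ = s`. -/
noncomputable def sphereOp (x : E) (s : ℝ) : E →L[ℝ] E :=
  s ^ 2 • ContinuousLinearMap.id ℝ E - (innerSL ℝ x).smulRight x

@[simp] lemma sphereOp_apply (x : E) (s : ℝ) (z : E) :
    sphereOp x s z = s ^ 2 • z - inner ℝ x z • x := by
  simp [sphereOp]

/-- The factor `s ^ 2 - ‖x‖ ^ 2` is what makes the lift tangent to the boundary of the cone. -/
lemma inner_sphereOp_self (x : E) (s : ℝ) (z : E) :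
    inner ℝ x (sphereOp x s z) = (s ^ 2 - ‖x‖ ^ 2) * inner ℝ x z := by
  rw [sphereOp_apply, inner_sub_right, inner_smul_right, inner_smul_right,
    real_inner_self_eq_norm_sq]
  ring

/-- Passage to the adjoint as a continuous linear map. -/
noncomputable def adjointCLM (E F : Type) [NormedAddCommGroup E] [InnerProductSpace ℝ E]
    [FiniteDimensional ℝ E] [NormedAddCommGroup F] [InnerProductSpace ℝ F]
    [FiniteDimensional ℝ F] : (E →L[ℝ] F) →L[ℝ] (F →L[ℝ] E) :=
  haveI := FiniteDimensional.complete ℝ E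
  haveI := FiniteDimensional.complete ℝ F
  LinearMap.toContinuousLinearMap
    { toFun := fun A => ContinuousLinearMap.adjoint A
      map_add' := fun A B => map_add _ A B
      map_smul' := fun c A => by simp }

lemma inner_adjointCLM (A : E →L[ℝ] F) (x : E) (y : F) :
    inner ℝ x (adjointCLM E F A y) = inner ℝ (A x) y :=
  haveI := FiniteDimensional.complete ℝ E
  haveI := FiniteDimensional.complete ℝ F
  ContinuousLinearMap.adjoint_inner_right A x y

/-- The operator `A P Aᵀ` where `P` is `sphereOp x s`. -/
noncomputable def gramOp (A : E →L[ℝ] F) (x : E) (s : ℝ) : F →L[ℝ] F :=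
  A ∘L (sphereOp x s ∘L adjointCLM E F A)

/-- With `z = Aᵀ w`, pairing with `w` gives `⟪P z, z⟫ = 0`, that is `s² ‖z‖² = ⟪x, z⟫²`. For `‖x‖ <
s`, Cauchy-Schwarz forces `z = 0`. For `‖x‖ = s`, `z` is a multiple of `x`, and it is orthogonal to
`u ∈ ker A`, which is not orthogonal to `x`. -/
lemma adjointCLM_eq_zero_of_gramOp {A : E →L[ℝ] F} {x : E} {s : ℝ} (hs : 0 < s) (hx : ‖x‖ ≤ s)
    (ht : ‖x‖ = s → ∃ u, A u = 0 ∧ inner ℝ u x ≠ 0) {w : F} (hw : gramOp A x s w = 0) :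
    adjointCLM E F A w = 0 := by
  set z := adjointCLM E F A w with hz
  have h1 : inner ℝ (sphereOp x s z) z = (0 : ℝ) := by
    rw [hz, inner_adjointCLM]
    change inner ℝ (gramOp A x s w) w = 0
    rw [hw, inner_zero_left]
  have h2 : s ^ 2 * ‖z‖ ^ 2 = inner ℝ x z ^ 2 := by
    rw [sphereOp_apply, inner_sub_left, inner_smul_left, inner_smul_left,
      real_inner_self_eq_norm_sq] at h1
    simp only [conj_trivial] at h1
    linarith
  rcases hx.lt_or_eq with hlt | heq
  · have h3 : inner ℝ x z ^ 2 ≤ (‖x‖ * ‖z‖) ^ 2 :=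
      sq_le_sq' (by linarith [neg_le_of_abs_le (abs_real_inner_le_norm x z)])
        (real_inner_le_norm x z)
    have h4 : 0 < s ^ 2 - ‖x‖ ^ 2 := by nlinarith [norm_nonneg x]
    have h5 : ‖z‖ ^ 2 ≤ 0 := by
      by_contra hne
      push Not at hne
      nlinarith [mul_pos h4 hne]
    exact norm_eq_zero.1 (pow_eq_zero_iff two_ne_zero |>.1 (le_antisymm h5 (sq_nonneg _)))
  · obtain ⟨u, hu, hux⟩ := ht heq
    have h3 : ‖s ^ 2 • z - inner ℝ x z • x‖ ^ 2 = 0 := by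
      rw [norm_sub_sq_real, inner_smul_left, inner_smul_right, norm_smul, norm_smul, mul_pow,
        mul_pow, heq, real_inner_comm x z]
      simp only [conj_trivial, Real.norm_eq_abs, sq_abs]
      linear_combination s ^ 2 * h2
    have h4 : s ^ 2 • z = inner ℝ x z • x :=
      sub_eq_zero.1 (norm_eq_zero.1 (pow_eq_zero_iff two_ne_zero |>.1 h3))
    have h5 : inner ℝ u z = (0 : ℝ) := by rw [hz, inner_adjointCLM, hu, inner_zero_left]
    have h6 := congrArg (fun y => inner ℝ u y) h4
    simp only [inner_smul_right, h5, mul_zero] at h6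
    have h7 : inner ℝ x z = (0 : ℝ) := by
      rcases mul_eq_zero.1 h6.symm with h | h
      · exact h
      · exact absurd h hux
    rw [h7, zero_smul] at h4
    exact (smul_eq_zero.1 h4).resolve_left (by positivity)

lemma isInvertible_gramOp {A : E →L[ℝ] F} (hA : Function.Surjective A) {x : E} {s : ℝ}
    (hs : 0 < s) (hx : ‖x‖ ≤ s) (ht : ‖x‖ = s → ∃ u, A u = 0 ∧ inner ℝ u x ≠ 0) :
    (gramOp A x s).IsInvertible := by
  have hinj : Function.Injective (gramOp A x s).toLinearMap := by
    rw [← LinearMap.ker_eq_bot, LinearMap.ker_eq_bot']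
    intro w hw
    have hz := adjointCLM_eq_zero_of_gramOp hs hx ht hw
    obtain ⟨a, rfl⟩ := hA w
    have := inner_adjointCLM A a (A a)
    rw [hz, inner_zero_right] at this
    exact inner_self_eq_zero.1 this.symm
  exact ⟨(LinearEquiv.ofInjectiveEndo _ hinj).toContinuousLinearEquiv, by ext; rfl⟩

variable (G : E → F)

/-- The right inverse `P Aᵀ (A P Aᵀ)⁻¹` of the differential `A` of `G` at `x`. -/
noncomputable def sphereLift (q : E × ℝ) : F →L[ℝ] E :=
  (sphereOp q.1 q.2 ∘L adjointCLM E F (fderiv ℝ G q.1)) ∘L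
    (gramOp (fderiv ℝ G q.1) q.1 q.2).inverse

/-- The lift along `(x, s) ↦ (G x, s)` of vectors, tangent to the cone `‖x‖ = s`. -/
noncomputable def coneLift (q : E × ℝ) : F × ℝ →L[ℝ] E × ℝ :=
  ((ContinuousLinearMap.snd ℝ F ℝ).smulRight (q.2⁻¹ • q.1) +
    sphereLift G q ∘L (ContinuousLinearMap.fst ℝ F ℝ -
      (ContinuousLinearMap.snd ℝ F ℝ).smulRight (q.2⁻¹ • fderiv ℝ G q.1 q.1))).prod
    (ContinuousLinearMap.snd ℝ F ℝ)

/-- The set on which `coneLift` is a lift. -/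
def coneDomain (δ : ℝ) : Set (E × ℝ) :=
  (ball 0 δ ×ˢ Ioi 0) ∩ (fun q => gramOp (fderiv ℝ G q.1) q.1 q.2) ⁻¹'
    range ((↑) : (F ≃L[ℝ] F) → F →L[ℝ] F)

variable {G} {δ : ℝ}

lemma contDiffOn_fderiv_fst (hG : ContDiffOn ℝ ∞ G (ball 0 δ)) :
    ContDiffOn ℝ ∞ (fun q : E × ℝ => fderiv ℝ G q.1) (ball 0 δ ×ˢ Ioi 0) :=
  (hG.fderiv_of_isOpen isOpen_ball (by simp)).comp contDiffOn_fst fun _ hq => hq.1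

lemma contDiff_sphereOp : ContDiff ℝ ∞ (fun q : E × ℝ => sphereOp q.1 q.2) := by
  unfold sphereOp
  refine ((contDiff_snd.pow 2).smul contDiff_const).sub ?_
  exact ((innerSL ℝ).contDiff.comp contDiff_fst).smulRight contDiff_fst

lemma contDiffOn_sphereOp_adjoint (hG : ContDiffOn ℝ ∞ G (ball 0 δ)) :
    ContDiffOn ℝ ∞ (fun q : E × ℝ => sphereOp q.1 q.2 ∘L adjointCLM E F (fderiv ℝ G q.1))
      (ball 0 δ ×ˢ Ioi 0) :=
  contDiff_sphereOp.contDiffOn.clm_comp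
    ((adjointCLM E F).contDiff.comp_contDiffOn (contDiffOn_fderiv_fst hG))

lemma contDiffOn_gramOp (hG : ContDiffOn ℝ ∞ G (ball 0 δ)) :
    ContDiffOn ℝ ∞ (fun q : E × ℝ => gramOp (fderiv ℝ G q.1) q.1 q.2) (ball 0 δ ×ˢ Ioi 0) :=
  (contDiffOn_fderiv_fst hG).clm_comp (contDiffOn_sphereOp_adjoint hG)

lemma isOpen_coneDomain (hG : ContDiffOn ℝ ∞ G (ball 0 δ)) : IsOpen (coneDomain G δ) :=
  haveI := FiniteDimensional.complete ℝ F
  (contDiffOn_gramOp hG).continuousOn.isOpen_inter_preimage (isOpen_ball.prod isOpen_Ioi)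
    (ContinuousLinearEquiv.isOpen (𝕜 := ℝ))

lemma contDiffOn_inverse_gramOp (hG : ContDiffOn ℝ ∞ G (ball 0 δ)) :
    ContDiffOn ℝ ∞ (fun q : E × ℝ => (gramOp (fderiv ℝ G q.1) q.1 q.2).inverse)
      (coneDomain G δ) := by
  have := FiniteDimensional.complete ℝ F
  rintro q ⟨hq, e, he⟩
  have h := contDiffAt_map_inverse (𝕜 := ℝ) (n := ∞) e
  simp only at he
  rw [he] at h
  exact h.comp_contDiffWithinAt q ((contDiffOn_gramOp hG q hq).mono inter_subset_left)

lemma contDiffOn_sphereLift (hG : ContDiffOn ℝ ∞ G (ball 0 δ)) :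
    ContDiffOn ℝ ∞ (sphereLift G) (coneDomain G δ) :=
  ((contDiffOn_sphereOp_adjoint hG).mono inter_subset_left).clm_comp
    (contDiffOn_inverse_gramOp hG)

lemma contDiffOn_inv_smul_fderiv (hG : ContDiffOn ℝ ∞ G (ball 0 δ)) :
    ContDiffOn ℝ ∞ (fun q : E × ℝ => q.2⁻¹ • fderiv ℝ G q.1 q.1) (coneDomain G δ) := by
  refine ContDiffOn.smul (contDiffOn_snd.inv fun q hq => (mem_Ioi.1 hq.1.2).ne') ?_
  exact ((contDiffOn_fderiv_fst hG).mono inter_subset_left).clm_apply contDiffOn_fst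

lemma contDiffOn_coneLift (hG : ContDiffOn ℝ ∞ G (ball 0 δ)) :
    ContDiffOn ℝ ∞ (coneLift G) (coneDomain G δ) := by
  have h1 : ContDiffOn ℝ ∞ (fun q : E × ℝ => q.2⁻¹ • q.1) (coneDomain G δ) :=
    (contDiffOn_snd.inv fun q hq => (mem_Ioi.1 hq.1.2).ne').smul contDiffOn_fst
  have h2 : ContDiffOn ℝ ∞ (fun q : E × ℝ =>
      (ContinuousLinearMap.snd ℝ F ℝ).smulRight (q.2⁻¹ • q.1) +
      sphereLift G q ∘L (ContinuousLinearMap.fst ℝ F ℝ -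
      (ContinuousLinearMap.snd ℝ F ℝ).smulRight (q.2⁻¹ • fderiv ℝ G q.1 q.1)))
      (coneDomain G δ) :=
    (contDiffOn_const.smulRight h1).add ((contDiffOn_sphereLift hG).clm_comp
      (contDiffOn_const.sub (contDiffOn_const.smulRight (contDiffOn_inv_smul_fderiv hG))))
  refine (((contDiffOn_const (c := ContinuousLinearMap.inl ℝ E ℝ)).clm_comp h2).add
    (contDiffOn_const (c := ContinuousLinearMap.inr ℝ E ℝ ∘L ContinuousLinearMap.snd ℝ F ℝ))).congr
    fun q _ => ContinuousLinearMap.ext fun v => ?_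
  ext1 <;> simp [coneLift]

lemma fderiv_sphereLift {q : E × ℝ} (hq : q ∈ coneDomain G δ) (w : F) :
    fderiv ℝ G q.1 (sphereLift G q w) = w := by
  obtain ⟨-, e, he⟩ := hq
  simp only at he
  change gramOp (fderiv ℝ G q.1) q.1 q.2 ((gramOp (fderiv ℝ G q.1) q.1 q.2).inverse w) = w
  rw [← he, ContinuousLinearMap.inverse_equiv]
  simp

lemma coneLift_apply (q : E × ℝ) (v : F × ℝ) : coneLift G q v =
    (v.2 • q.2⁻¹ • q.1 + sphereLift G q (v.1 - v.2 • q.2⁻¹ • fderiv ℝ G q.1 q.1), v.2) := rfl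

lemma hasFDerivAt_coneMap (hG : ContDiffOn ℝ ∞ G (ball 0 δ)) {q : E × ℝ}
    (hq : q.1 ∈ ball (0 : E) δ) : HasFDerivAt (fun q : E × ℝ => (G q.1, q.2))
      (((fderiv ℝ G q.1) ∘L ContinuousLinearMap.fst ℝ E ℝ).prod
        (ContinuousLinearMap.snd ℝ E ℝ)) q :=
  (((hG.contDiffAt (isOpen_ball.mem_nhds hq)).differentiableAt (by simp)).hasFDerivAt.comp q
    hasFDerivAt_fst).prodMk hasFDerivAt_snd

lemma hasFDerivAt_coneBound (q : E × ℝ) : HasFDerivAt (fun q : E × ℝ => q.2 ^ 2 - ‖q.1‖ ^ 2)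
    ((2 * q.2) • ContinuousLinearMap.snd ℝ E ℝ -
      (2 • (innerSL ℝ q.1)) ∘L ContinuousLinearMap.fst ℝ E ℝ) q := by
  have h1 : HasFDerivAt (fun q : E × ℝ => q.2 ^ 2)
      ((2 * q.2) • ContinuousLinearMap.snd ℝ E ℝ) q := by
    simpa using (hasFDerivAt_snd (𝕜 := ℝ) (E := E) (F := ℝ) (p := q)).pow 2
  exact h1.sub ((hasStrictFDerivAt_norm_sq q.1).hasFDerivAt.comp q hasFDerivAt_fst)

/-- `coneLift` satisfies the hypotheses of the transport theorem. -/
theorem isLiftingField_coneLift (hG : ContDiffOn ℝ ∞ G (ball 0 δ)) {O : Set (F × ℝ)}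
    (hO : ∀ y ∈ O, y.2 ∈ Ioo 0 δ)
    (hreg : ∀ x s, ‖x‖ ≤ s → (G x, s) ∈ O → Function.Surjective (fderiv ℝ G x) ∧
      (‖x‖ = s → ∃ u, fderiv ℝ G x u = 0 ∧ inner ℝ u x ≠ 0)) :
    IsLiftingField (coneDomain G δ) (fun q : E × ℝ => (G q.1, q.2))
      (fun q => q.2 ^ 2 - ‖q.1‖ ^ 2) (coneLift G) O where
  isOpen := isOpen_coneDomain hG
  contDiffOn := contDiffOn_coneLift hG
  differentiableAt q hq := (hasFDerivAt_coneMap hG hq.1.1).differentiableAt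
  lift q hq v := by
    rw [(hasFDerivAt_coneMap hG hq.1.1).fderiv, coneLift_apply]
    ext1 <;> simp [fderiv_sphereLift hq]
  differentiableAt_bound q _ := (hasFDerivAt_coneBound q).differentiableAt
  tangent v := by
    -- The motion of `s` and the radial term together change `ρ` at rate `2 ρ v.2 / s`; the
    -- spherical term contributes a multiple of `ρ` by `inner_sphereOp_self`.
    refine ⟨fun q => 2 * (v.2 * q.2⁻¹ - inner ℝ q.1 (adjointCLM E F (fderiv ℝ G q.1)
      ((gramOp (fderiv ℝ G q.1) q.1 q.2).inverse
        (v.1 - v.2 • q.2⁻¹ • fderiv ℝ G q.1 q.1)))), ?_, fun q hq => ?_⟩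
    · have h1 : ContinuousOn (fun q : E × ℝ => adjointCLM E F (fderiv ℝ G q.1))
          (coneDomain G δ) :=
        (adjointCLM E F).continuous.comp_continuousOn
          ((contDiffOn_fderiv_fst hG).continuousOn.mono inter_subset_left)
      have h2 : ContinuousOn (fun q : E × ℝ => v.2 * q.2⁻¹) (coneDomain G δ) :=
        continuousOn_const.mul (continuousOn_snd.inv₀ fun q hq => (mem_Ioi.1 hq.1.2).ne')
      have h3 : ContinuousOn (fun q : E × ℝ => v.1 - v.2 • q.2⁻¹ • fderiv ℝ G q.1 q.1)
          (coneDomain G δ) :=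
        continuousOn_const.sub (continuousOn_const.smul
          (contDiffOn_inv_smul_fderiv hG).continuousOn)
      exact continuousOn_const.mul (h2.sub (continuousOn_fst.inner
        (h1.clm_apply ((contDiffOn_inverse_gramOp hG).continuousOn.clm_apply h3))))
    · have hq2 : q.2 ≠ 0 := (mem_Ioi.1 hq.1.2).ne'
      have key : ∀ w, inner ℝ q.1 (sphereLift G q w) = (q.2 ^ 2 - ‖q.1‖ ^ 2) *
          inner ℝ q.1 (adjointCLM E F (fderiv ℝ G q.1)
            ((gramOp (fderiv ℝ G q.1) q.1 q.2).inverse w)) :=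
        fun w => inner_sphereOp_self _ _ _
      rw [(hasFDerivAt_coneBound q).fderiv, coneLift_apply]
      simp only [sub_apply, smul_apply, ContinuousLinearMap.coe_comp, Function.comp_apply,
        ContinuousLinearMap.coe_snd', ContinuousLinearMap.coe_fst', innerSL_apply_apply,
        inner_add_right, inner_smul_right, real_inner_self_eq_norm_sq, key, smul_eq_mul,
        nsmul_eq_mul, Nat.cast_ofNat]
      field_simp
      ring
  subset q hq hqO := by
    have hs := hO _ hqO
    have hle : ‖q.1‖ ≤ q.2 := (sq_le_sq₀ (norm_nonneg _) hs.1.le).1 (sub_nonneg.1 hq)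
    obtain ⟨h1, h2⟩ := hreg q.1 q.2 hle hqO
    exact ⟨⟨by simpa using hle.trans_lt hs.2, hs.1⟩, isInvertible_gramOp h1 hs.1 hle h2⟩
  proper C hCO hC := by
    rcases C.eq_empty_or_nonempty with rfl | hne
    · simp
    -- The largest radius occurring in `C` is less than `δ`, so `G` is continuous on the
    -- corresponding closed ball.
    obtain ⟨y, hyC, hy⟩ := hC.exists_isMaxOn hne continuousOn_snd
    have hK : IsCompact (closedBall (0 : E) y.2 ×ˢ (Prod.snd '' C)) :=
      (isCompact_closedBall 0 y.2).prod (hC.image continuous_snd)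
    have hGc : ContinuousOn (fun q : E × ℝ => (q.2 ^ 2 - ‖q.1‖ ^ 2, (G q.1, q.2)))
        (closedBall (0 : E) y.2 ×ˢ (Prod.snd '' C)) := by
      refine ContinuousOn.prodMk (by fun_prop) (ContinuousOn.prodMk ?_ continuousOn_snd)
      exact hG.continuousOn.comp continuousOn_fst fun q hq =>
        closedBall_subset_ball (hO y (hCO hyC)).2 hq.1
    have hcl := hGc.preimage_isClosed_of_isClosed hK.isClosed
      (isClosed_Ici (a := (0 : ℝ)).prod hC.isClosed)
    refine (congrArg IsCompact (Set.ext fun q => ?_)).mpr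
      (hK.of_isClosed_subset hcl inter_subset_left)
    refine ⟨fun hq => ⟨⟨?_, mem_image_of_mem _ hq.2⟩, hq⟩, fun hq => hq.2⟩
    have hs := hO _ (hCO hq.2)
    have hle : ‖q.1‖ ≤ q.2 := (sq_le_sq₀ (norm_nonneg _) hs.1.le).1 (sub_nonneg.1 hq.1)
    simpa using hle.trans (hy hq.2)

end SphericalLift

-- Germs of discriminants and regularity near the origin.

section GermLemmas

lemma eventuallyEq_closure {X : Type*} [TopologicalSpace X] {A B : Set X} {a : X}
    (h : A =ᶠ[𝓝 a] B) : (closure A : Set X) =ᶠ[𝓝 a] (closure B : Set X) := by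
  filter_upwards [eventually_eventually_nhds.2 h] with y hy
  refine propext ?_
  change y ∈ closure A ↔ y ∈ closure B
  rw [mem_closure_iff_frequently, mem_closure_iff_frequently]
  exact frequently_congr (hy.mono fun z hz => iff_of_eq hz)

lemma eventuallyEq_frontier {X : Type*} [TopologicalSpace X] {A B : Set X} {a : X}
    (h : A =ᶠ[𝓝 a] B) : (frontier A : Set X) =ᶠ[𝓝 a] (frontier B : Set X) := by
  rw [frontier_eq_closure_inter_closure, frontier_eq_closure_inter_closure]
  exact (eventuallyEq_closure h).inter (eventuallyEq_closure h.compl)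

variable {m p : ℕ} {G : EuclideanSpace ℝ (Fin m) → EuclideanSpace ℝ (Fin p)}

lemma isClosed_disc (r : ℝ) : IsClosed (disc G r) :=
  isClosed_closure.union isClosed_frontier

lemma eventuallyEq_disc {r r' : ℝ}
    (h : (G '' (ball 0 r ∩ univ) : Set (EuclideanSpace ℝ (Fin p))) =ᶠ[𝓝 0]
      (G '' (ball 0 r' ∩ univ)))
    (hs : (G '' (ball 0 r ∩ sing G) : Set (EuclideanSpace ℝ (Fin p))) =ᶠ[𝓝 0]
      (G '' (ball 0 r' ∩ sing G))) :
    (disc G r : Set (EuclideanSpace ℝ (Fin p))) =ᶠ[𝓝 0] (disc G r') := by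
  rw [inter_univ, inter_univ] at h
  exact (eventuallyEq_closure hs).union (eventuallyEq_frontier h)

lemma FibreTransverseSphere.exists_ker {x : EuclideanSpace ℝ (Fin m)}
    (h : FibreTransverseSphere G x) : ∃ u, fderiv ℝ G x u = 0 ∧ inner ℝ u x ≠ 0 := by
  obtain ⟨hx, -, htop⟩ := h
  by_contra hcon
  push Not at hcon
  have hle : LinearMap.ker (fderiv ℝ G x).toLinearMap ≤ (Submodule.span ℝ {x})ᗮ := fun u hu =>
    Submodule.mem_orthogonal_singleton_iff_inner_left.2 (hcon u hu)
  rw [sup_eq_right.2 hle] at htop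
  have : x ∈ (Submodule.span ℝ {x})ᗮ := htop ▸ Submodule.mem_top
  exact hx (inner_self_eq_zero.1 (Submodule.mem_orthogonal_singleton_iff_inner_left.1 this))

/-- Near the origin, over the complement of the discriminant, `G` is submersive, and its fibres
are transverse to the spheres of radius bounded away from zero. -/
theorem exists_regular_radius (hG : AnalyticAt ℝ G 0) (hnice : IsNice G)
    (hM : MilnorCondition G) :
    ∃ δ > 0, ContDiffOn ℝ ∞ G (ball 0 δ) ∧ ∀ r ∈ Ioo 0 δ, ∀ a > 0, ∀ b ∈ Ioo 0 δ, ∃ η > 0,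
      ∀ x, ‖x‖ ≤ b → G x ∈ ball 0 η \ disc G r → Function.Surjective (fderiv ℝ G x) ∧
        (a ≤ ‖x‖ → ∃ u, fderiv ℝ G x u = 0 ∧ inner ℝ u x ≠ 0) := by
  obtain ⟨δ₁, hδ₁, hGδ⟩ := hG.exists_ball_analyticOnNhd
  obtain ⟨⟨δ₂, hδ₂, hI⟩, δ₃, hδ₃, hS⟩ := hnice
  -- The neighbourhood in the Milnor condition depends on the radius; one radius `R` is fixed, and
  -- other discriminants are compared with `disc G R` near `0`.
  obtain ⟨R, hRM, hR⟩ :=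
    (hM.and (Ioo_mem_nhdsGT (lt_min hδ₂ hδ₃) : ∀ᶠ r in 𝓝[>] (0 : ℝ), _)).exists
  obtain ⟨δ₄, hδ₄, hR4⟩ := Metric.eventually_nhds_iff_ball.1 hRM
  have hR2 : R ∈ Ioo 0 δ₂ := ⟨hR.1, hR.2.trans_le (min_le_left _ _)⟩
  have hR3 : R ∈ Ioo 0 δ₃ := ⟨hR.1, hR.2.trans_le (min_le_right _ _)⟩
  refine ⟨min (min δ₁ δ₂) (min δ₃ δ₄), by positivity, ?_, ?_⟩
  · exact hGδ.contDiffOn (isOpen_ball.uniqueDiffOn) |>.mono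
      (ball_subset_ball ((min_le_left _ _).trans (min_le_left _ _)))
  intro r hr a ha b hb
  simp only [mem_Ioo, lt_min_iff] at hr hb
  obtain ⟨hr0, ⟨-, hr2⟩, hr3, -⟩ := hr
  obtain ⟨hb0, ⟨hb1, -⟩, hb3, hb4⟩ := hb
  have hcont : ∀ x : EuclideanSpace ℝ (Fin m), ‖x‖ ≤ b → ContinuousAt G x := fun x hx =>
    (hGδ x (by simpa using hx.trans_lt hb1)).continuousAt
  have hdisc := eventuallyEq_disc (hI r ⟨hr0, hr2⟩ R hR2) (hS r ⟨hr0, hr3⟩ R hR3)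
  -- Any radius strictly between `b` and `δ₃` serves: its open ball contains the closed ball of
  -- radius `b`.
  have hsing := hS ((b + δ₃) / 2) ⟨by linarith, by linarith⟩ r ⟨hr0, hr3⟩
  have hK : IsCompact {x : EuclideanSpace ℝ (Fin m) | a ≤ ‖x‖ ∧ ‖x‖ ≤ b} := by
    refine (isCompact_closedBall 0 b).of_isClosed_subset ?_ fun x hx => by simpa using hx.2
    exact (isClosed_le continuous_const continuous_norm).inter
      (isClosed_le continuous_norm continuous_const)
  -- Where `G x = 0`, the Milnor condition applies since `x ≠ 0`; elsewhere `‖G‖ < η` fails nearby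
  -- for small `η`. Compactness of the shell then gives a uniform `η`.
  have hloc : ∀ x ∈ {x : EuclideanSpace ℝ (Fin m) | a ≤ ‖x‖ ∧ ‖x‖ ≤ b},
      ∀ᶠ q : ℝ × EuclideanSpace ℝ (Fin m) in 𝓝 0 ×ˢ 𝓝 x,
        ‖G q.2‖ < q.1 → G q.2 ∉ disc G r → FibreTransverseSphere G q.2 := by
    rintro x ⟨hxa, hxb⟩
    have hcx : Tendsto (fun q : ℝ × EuclideanSpace ℝ (Fin m) => G q.2) (𝓝 0 ×ˢ 𝓝 x) (𝓝 (G x)) :=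
      (hcont x hxb).tendsto.comp tendsto_snd
    by_cases hx0 : G x = 0
    · have hxne : x ≠ 0 := fun h => by
        rw [h, norm_zero] at hxa
        exact absurd hxa (not_le.2 ha)
      have hncl : x ∉ closure (milnorSet G \ G ⁻¹' disc G R) := fun hcl =>
        hxne (hR4 x (by simpa using hxb.trans_lt hb4) ⟨hcl, hx0⟩)
      have h1 : ∀ᶠ q : ℝ × EuclideanSpace ℝ (Fin m) in 𝓝 0 ×ˢ 𝓝 x,
          q.2 ∉ milnorSet G \ G ⁻¹' disc G R :=
        tendsto_snd.eventually (mem_of_superset (isClosed_closure.isOpen_compl.mem_nhds hncl)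
          fun z hz hz' => hz (subset_closure hz'))
      rw [hx0] at hcx
      filter_upwards [h1, hcx.eventually hdisc] with q hq hd _ hnd
      by_contra hnt
      exact hq ⟨hnt, fun hqR => hnd ((iff_of_eq hd).2 hqR)⟩
    · have h1 : ∀ᶠ q : ℝ × EuclideanSpace ℝ (Fin m) in 𝓝 0 ×ˢ 𝓝 x, q.1 < ‖G q.2‖ :=
        tendsto_fst.eventually_lt hcx.norm (norm_pos_iff.2 hx0)
      filter_upwards [h1] with q hq hq'
      exact absurd hq' hq.le.not_gt
  have hunif := hK.eventually_forall_of_forall_eventually (x₀ := (0 : ℝ))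
    (P := fun η x => ‖G x‖ < η → G x ∉ disc G r → FibreTransverseSphere G x)
    (fun x hx => by rw [nhds_prod_eq]; exact hloc x hx)
  obtain ⟨η₁, hη₁, hball⟩ := Metric.eventually_nhds_iff_ball.1 hsing
  obtain ⟨η₂, hη₂, hη₂'⟩ :=
    ((hunif.filter_mono nhdsWithin_le_nhds).and (self_mem_nhdsWithin (s := Ioi (0 : ℝ)))).exists
  refine ⟨min η₁ η₂, lt_min hη₁ hη₂', fun x hxb hx => ?_⟩
  obtain ⟨hxη, hxd⟩ := hx
  rw [mem_ball_zero_iff, lt_min_iff] at hxη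
  refine ⟨?_, fun hxa => (hη₂ x ⟨hxa, hxb⟩ hxη.2 hxd).exists_ker⟩
  by_contra hns
  refine hxd (Or.inl (subset_closure ?_))
  refine (iff_of_eq (hball (G x) (by simpa using hxη.1))).1 ⟨x, ⟨?_, hns⟩, rfl⟩
  rw [mem_ball_zero_iff]
  linarith

end GermLemmas

-- Diffeomorphisms over a base and typical fibres.

section Diffeo

variable {E F E' B : Type*} [NormedAddCommGroup E] [NormedSpace ℝ E]
  [NormedAddCommGroup F] [NormedSpace ℝ F] [NormedAddCommGroup E'] [NormedSpace ℝ E']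

lemma SmoothOnSet.of_contDiffOn {f : E → F} {X U : Set E} (hU : IsOpen U) (hXU : X ⊆ U)
    (hf : ContDiffOn ℝ ∞ f U) : SmoothOnSet f X :=
  fun _ hx => ⟨U, hU, hXU hx, f, hf, fun _ _ => rfl⟩

lemma SmoothOnSet.mono {f : E → F} {X Y : Set E} (hf : SmoothOnSet f X) (h : Y ⊆ X) :
    SmoothOnSet f Y := by
  intro x hx
  obtain ⟨U, hU, hxU, g, hg, he⟩ := hf x (h hx)
  exact ⟨U, hU, hxU, g, hg, he.mono (inter_subset_inter_right _ h)⟩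

lemma SmoothOnSet.comp {f : E → F} {g : F → E'} {X : Set E} {Y : Set F}
    (hg : SmoothOnSet g Y) (hf : SmoothOnSet f X) (h : MapsTo f X Y) :
    SmoothOnSet (g ∘ f) X := by
  intro x hx
  obtain ⟨U, hU, hxU, f', hf', he⟩ := hf x hx
  obtain ⟨W, hW, hxW, g', hg', he'⟩ := hg (f x) (h hx)
  refine ⟨U ∩ f' ⁻¹' W, hf'.continuousOn.isOpen_inter_preimage hU hW, ⟨hxU, ?_⟩, g' ∘ f',
    hg'.comp (hf'.mono inter_subset_left) fun z hz => hz.2, ?_⟩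
  · rw [mem_preimage, ← he ⟨hxU, hx⟩]
    exact hxW
  · rintro z ⟨⟨hzU, hzW⟩, hzX⟩
    have hz := he ⟨hzU, hzX⟩
    simp only [Function.comp_apply]
    rw [← hz]
    exact he' ⟨hz ▸ hzW, h hzX⟩

lemma DiffeoOver.symm {X : Set E} {π : E → B} {Y : Set F} {π' : F → B}
    (h : DiffeoOver X π Y π') : DiffeoOver Y π' X π := by
  obtain ⟨φ, ψ, hφ, hψ, hl, hr, hsφ, hsψ, hc⟩ := h
  exact ⟨ψ, φ, hψ, hφ, hr, hl, hsψ, hsφ, fun y hy => by rw [← hc _ (hψ hy), hr hy]⟩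

lemma DiffeoOver.trans {X : Set E} {π : E → B} {Y : Set F} {π' : F → B} {Z : Set E'}
    {π'' : E' → B} (h : DiffeoOver X π Y π') (h' : DiffeoOver Y π' Z π'') :
    DiffeoOver X π Z π'' := by
  obtain ⟨φ, ψ, hφ, hψ, hl, hr, hsφ, hsψ, hc⟩ := h
  obtain ⟨φ', ψ', hφ', hψ', hl', hr', hsφ', hsψ', hc'⟩ := h'
  refine ⟨φ' ∘ φ, ψ ∘ ψ', hφ'.comp hφ, hψ.comp hψ', hl.comp hl' hφ, hr.comp hr' hψ',
    hsφ'.comp hsφ hφ, hsψ.comp hsψ' hψ', fun x hx => ?_⟩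
  rw [Function.comp_apply, hc' _ (hφ hx), hc x hx]

lemma SmoothOnSet.prodMap_id {f : E → E'} {X : Set E} (W : Set F) (hf : SmoothOnSet f X) :
    SmoothOnSet (Prod.map (id : F → F) f) (W ×ˢ X) := by
  rintro ⟨y, x⟩ ⟨-, hx⟩
  obtain ⟨U, hU, hxU, g, hg, he⟩ := hf x hx
  refine ⟨univ ×ˢ U, isOpen_univ.prod hU, ⟨trivial, hxU⟩, Prod.map id g,
    contDiffOn_id.prodMap hg, ?_⟩
  rintro ⟨z, w⟩ ⟨⟨-, hwU⟩, -, hwX⟩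
  exact Prod.ext rfl (he ⟨hwU, hwX⟩)

/-- A diffeomorphism of fibres induces a diffeomorphism of products. -/
lemma DiffeoOver.prod {T : Set E} {T' : Set E'} (W : Set F)
    (h : DiffeoOver T (fun _ => ()) T' (fun _ => ())) :
    DiffeoOver (W ×ˢ T) (Prod.fst : F × E → F) (W ×ˢ T') (Prod.fst : F × E' → F) := by
  obtain ⟨φ, ψ, hφ, hψ, hl, hr, hsφ, hsψ, -⟩ := h
  exact ⟨Prod.map id φ, Prod.map id ψ, (mapsTo_id _).prodMap hφ, (mapsTo_id _).prodMap hψ,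
    fun q hq => Prod.ext rfl (hl hq.2), fun q hq => Prod.ext rfl (hr hq.2),
    hsφ.prodMap_id W, hsψ.prodMap_id W, fun _ _ => rfl⟩

/-- The fibres of a trivial fibration are diffeomorphic to the typical fibre. -/
lemma DiffeoOver.fibre {G : E → F} {X : Set E} {W : Set F} {T : Set E'} {y : F} (hy : y ∈ W)
    (h : DiffeoOver (X ∩ G ⁻¹' W) G (W ×ˢ T) (Prod.fst : F × E' → F)) :
    DiffeoOver (X ∩ G ⁻¹' {y}) (fun _ => ()) T (fun _ => ()) := by
  obtain ⟨φ, ψ, hφ, hψ, hl, hr, hsφ, hsψ, hc⟩ := h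
  have hsub : X ∩ G ⁻¹' {y} ⊆ X ∩ G ⁻¹' W := fun x hx =>
    ⟨hx.1, by rw [mem_preimage, show G x = y from hx.2]; exact hy⟩
  have hG : ∀ t ∈ T, G (ψ (y, t)) = y := fun t ht => by
    rw [← hc _ (hψ ⟨hy, ht⟩), hr ⟨hy, ht⟩]
  have hin : MapsTo (fun t : E' => (y, t)) T (W ×ˢ T) := fun t ht => ⟨hy, ht⟩
  refine ⟨Prod.snd ∘ φ, ψ ∘ (fun t => (y, t)), fun x hx => (hφ (hsub hx)).2,
    fun t ht => ⟨(hψ ⟨hy, ht⟩).1, hG t ht⟩, fun x hx => ?_, fun t ht => ?_, ?_, ?_,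
    fun _ _ => rfl⟩
  · have hx1 : (φ x).1 = y := (hc x (hsub hx)).trans hx.2
    have : (y, (φ x).2) = φ x := Prod.ext hx1.symm rfl
    simp only [Function.comp_apply, this]
    exact hl (hsub hx)
  · simp only [Function.comp_apply]
    rw [hr ⟨hy, ht⟩]
  · exact (SmoothOnSet.of_contDiffOn isOpen_univ (subset_univ _) contDiffOn_snd).comp
      (hsφ.mono hsub) (mapsTo_univ _ _)
  · exact hsψ.comp (SmoothOnSet.of_contDiffOn isOpen_univ (subset_univ _)
      (contDiff_prodMk_right y).contDiffOn) hin

/-- If `G` is trivial near each point of the open set `U`, then it is locally trivial, with a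
single typical fibre, over each connected component of `U`. -/
theorem isLocallyTrivialOver_connectedComponentIn {G : E → F} {X : Set E} {U : Set F}
    (h : ∀ y ∈ U, ∃ R > 0, ball y R ⊆ U ∧ DiffeoOver (X ∩ G ⁻¹' ball y R) G
      (ball y R ×ˢ (X ∩ G ⁻¹' {y})) (Prod.fst : F × E → F)) {y : F} (hy : y ∈ U) :
    IsLocallyTrivialOver G (X ∩ G ⁻¹' U) (connectedComponentIn U y) := by
  have hfib : ∀ z ∈ connectedComponentIn U y, DiffeoOver (X ∩ G ⁻¹' {z}) (fun _ => ())
      (X ∩ G ⁻¹' {y}) (fun _ => ()) := by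
    -- Having diffeomorphic fibres is an equivalence relation with locally constant classes, so it
    -- holds throughout a connected set.
    intro z hz
    refine isPreconnected_connectedComponentIn.induction₂
      (fun z w => DiffeoOver (X ∩ G ⁻¹' {z}) (fun _ => ()) (X ∩ G ⁻¹' {w}) (fun _ => ()))
      (fun w hw => ?_) (fun _ _ _ _ _ _ h1 h2 => h1.trans h2) (fun _ _ _ _ h1 => h1.symm)
      hz (mem_connectedComponentIn hy)
    obtain ⟨R, hR, -, hd⟩ := h w (connectedComponentIn_subset _ _ hw)
    filter_upwards [nhdsWithin_le_nhds (ball_mem_nhds w hR)] with w' hw'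
    exact (hd.fibre hw').symm
  refine ⟨X ∩ G ⁻¹' {y}, fun z hz => ?_⟩
  obtain ⟨R, hR, hRU, hd⟩ := h z (connectedComponentIn_subset _ _ hz)
  refine ⟨ball z R, isOpen_ball, mem_ball_self hR, ?_, ?_⟩
  · rw [connectedComponentIn_eq hz]
    exact (convex_ball z R).isPreconnected.subset_connectedComponentIn (mem_ball_self hR) hRU
  · have hset : X ∩ G ⁻¹' U ∩ G ⁻¹' ball z R = X ∩ G ⁻¹' ball z R := by
      rw [inter_assoc, ← preimage_inter, inter_eq_right.2 hRU]
    rw [hset]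
    exact hd.trans ((hfib z hz).prod _)

end Diffeo

-- Trivializations and change of radius by transport.

section Trivialization

set_option linter.unusedSectionVars false

variable {E F : Type} [NormedAddCommGroup E] [NormedSpace ℝ E] [FiniteDimensional ℝ E]
  [NormedAddCommGroup F] [NormedSpace ℝ F] [FiniteDimensional ℝ F]
  {G : E → F} {δ : ℝ} {Ω : Set (E × ℝ)} {ξ : E × ℝ → F × ℝ →L[ℝ] E × ℝ} {U : Set F} {a b : ℝ}

/-- Transport in the cone over the family of balls centred at the origin. -/
abbrev ConeTransports (G : E → F) (ξ : E × ℝ → F × ℝ →L[ℝ] E × ℝ) :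
    E × ℝ → F × ℝ → E × ℝ → Prop :=
  Transports (fun q : E × ℝ => (G q.1, q.2)) (fun q => q.2 ^ 2 - ‖q.1‖ ^ 2) ξ

lemma mem_ball_iff_coneBound {x : E} {s : ℝ} (hs : 0 < s) :
    x ∈ ball (0 : E) s ↔ 0 < s ^ 2 - ‖x‖ ^ 2 := by
  rw [mem_ball_zero_iff, sub_pos, sq_lt_sq₀ (norm_nonneg x) hs.le]

lemma ConeTransports.end_eq {x : E} {s σ : ℝ} {v : F} {z : E × ℝ}
    (h : ConeTransports G ξ (x, s) (v, σ) z) : G z.1 = G x + v ∧ z.2 = s + σ :=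
  Prod.ext_iff.1 h.map_eq

lemma ConeTransports.mem_ball {x : E} {s σ : ℝ} {v : F} {z : E × ℝ}
    (h : ConeTransports G ξ (x, s) (v, σ) z) (hs : 0 < s) (hσ : 0 < s + σ)
    (hx : x ∈ ball (0 : E) s) : z.1 ∈ ball (0 : E) (s + σ) := by
  have h1 := h.pos_iff.1 ((mem_ball_iff_coneBound hs).1 hx)
  rw [h.end_eq.2] at h1
  exact (mem_ball_iff_coneBound hσ).2 h1

/-- Each point is carried to the central fibre along the segment from `G x` to `y`, with the radius
`ε` fixed; the inverse is transport along the reversed segment. -/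
lemma exists_trivialization_ball (hG : ContDiffOn ℝ ∞ G (ball 0 δ)) (hU : IsOpen U)
    (h : IsLiftingField Ω (fun q : E × ℝ => (G q.1, q.2)) (fun q => q.2 ^ 2 - ‖q.1‖ ^ 2) ξ
      (U ×ˢ Ioo a b)) {ε : ℝ} (hε0 : 0 < ε) (hε : ε ∈ Ioo a b) (hεδ : ε ≤ δ) {y : F}
    (hy : y ∈ U) :
    ∃ R > 0, ball y R ⊆ U ∧ DiffeoOver (ball 0 ε ∩ G ⁻¹' ball y R) G
      (ball y R ×ˢ (ball 0 ε ∩ G ⁻¹' {y})) (Prod.fst : F × E → F) := by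
  obtain ⟨R, hR, hRU⟩ := nhds_basis_closedBall.mem_iff.1 (hU.mem_nhds hy)
  have hCO : closedBall y R ×ˢ {ε} ⊆ U ×ˢ Ioo a b :=
    prod_mono hRU (singleton_subset_iff.2 hε)
  have : CompleteSpace F := FiniteDimensional.complete ℝ F
  obtain ⟨Ψ, hΨ, hΨt⟩ := h.exists_transport ((isCompact_closedBall y R).prod isCompact_singleton)
    hCO
  have hseg : ∀ x z : F, x ∈ closedBall y R → z ∈ closedBall y R → ∀ t ∈ Icc (0 : ℝ) 1,
      ((x, ε) : F × ℝ) + t • (z - x, (0 : ℝ)) ∈ closedBall y R ×ˢ {ε} := by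
    intro x z hx hz t ht
    refine ⟨?_, by simp⟩
    have := (convex_closedBall y R).add_smul_sub_mem hx hz ht
    simpa using this
  have htr : ∀ x ∈ ball (0 : E) ε, G x ∈ ball y R → ∀ z ∈ ball y R,
      ConeTransports G ξ (x, ε) (z - G x, 0) (Ψ (x, ε) (z - G x, 0)) := fun x hx hGx z hz =>
    hΨt _ _ ((mem_ball_iff_coneBound hε0).1 hx).le
      (hseg _ _ (ball_subset_closedBall hGx) (ball_subset_closedBall hz))
  have hend : ∀ x ∈ ball (0 : E) ε, G x ∈ ball y R → ∀ z ∈ ball y R,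
      (Ψ (x, ε) (z - G x, 0)).1 ∈ ball (0 : E) ε ∧ G (Ψ (x, ε) (z - G x, 0)).1 = z ∧
      (Ψ ((Ψ (x, ε) (z - G x, 0)).1, ε) (G x - z, 0)).1 = x := by
    intro x hx hGx z hz
    have ht := htr x hx hGx z hz
    obtain ⟨e1, e2⟩ := ht.end_eq
    have hmem : (Ψ (x, ε) (z - G x, 0)).1 ∈ ball (0 : E) ε := by
      simpa using ConeTransports.mem_ball ht hε0 (by simpa using hε0) hx
    have hGz : G (Ψ (x, ε) (z - G x, 0)).1 = z := by rw [e1]; abel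
    refine ⟨hmem, hGz, ?_⟩
    have hpair : Ψ (x, ε) (z - G x, 0) = ((Ψ (x, ε) (z - G x, 0)).1, ε) :=
      Prod.ext rfl (by simpa using e2)
    have ht' := htr _ hmem (hGz.symm ▸ hz) (G x) hGx
    rw [hGz] at ht'
    have hs := ht.symm
    rw [hpair] at hs
    have hneg : -((z - G x, 0) : F × ℝ) = (G x - z, 0) := by simp
    rw [hneg] at hs
    refine congrArg Prod.fst (h.transports_unique (fun t hmt => ?_) ht' hs)
    simp only [hGz]
    exact hCO (hseg z (G x) (ball_subset_closedBall hz) (ball_subset_closedBall hGx) t hmt)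
  have hyR : y ∈ ball y R := mem_ball_self hR
  refine ⟨R, hR, ball_subset_closedBall.trans hRU,
    fun x => (G x, (Ψ (x, ε) (y - G x, 0)).1), fun q => (Ψ (q.2, ε) (q.1 - y, 0)).1,
    fun x hx => ⟨hx.2, ?_⟩, ?_, fun x hx => ?_, ?_, ?_, ?_, fun x _ => rfl⟩
  · obtain ⟨h1, h2, -⟩ := hend x hx.1 hx.2 y hyR
    exact ⟨h1, h2⟩
  · rintro ⟨z, x⟩ ⟨hz, hx, hGx⟩
    rw [mem_preimage, mem_singleton_iff] at hGx
    obtain ⟨h1, h2, -⟩ := hend x hx (by rw [hGx]; exact hyR) z hz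
    rw [hGx] at h1 h2
    exact ⟨h1, by rw [mem_preimage, h2]; exact hz⟩
  · exact (hend x hx.1 hx.2 y hyR).2.2
  · rintro ⟨z, x⟩ ⟨hz, hx, hGx⟩
    rw [mem_preimage, mem_singleton_iff] at hGx
    obtain ⟨-, h2, h3⟩ := hend x hx (by rw [hGx]; exact hyR) z hz
    rw [hGx] at h2 h3
    simp only [h2, h3]
  · refine SmoothOnSet.of_contDiffOn (U := ball 0 δ) isOpen_ball
      (inter_subset_left.trans (ball_subset_ball hεδ)) (hG.prodMk ?_)
    have hin : ContDiffOn ℝ ∞ (fun x => (((x, ε) : E × ℝ), ((y - G x, 0) : F × ℝ)))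
        (ball 0 δ) :=
      (contDiffOn_id.prodMk contDiffOn_const).prodMk
        ((contDiffOn_const.sub hG).prodMk contDiffOn_const)
    exact contDiff_fst.comp_contDiffOn (hΨ.comp_contDiffOn hin)
  · refine SmoothOnSet.of_contDiffOn isOpen_univ (subset_univ _) (ContDiff.contDiffOn ?_)
    have hin : ContDiff ℝ ∞ (fun q : F × E => (((q.2, ε) : E × ℝ), ((q.1 - y, 0) : F × ℝ))) := by
      fun_prop
    exact contDiff_fst.comp (hΨ.comp hin)

/-- The radii of the balls can be changed by a smooth map which preserves `G`. -/
lemma exists_radial_transport (hG : ContDiffOn ℝ ∞ G (ball 0 δ)) (hU : IsOpen U)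
    (h : IsLiftingField Ω (fun q : E × ℝ => (G q.1, q.2)) (fun q => q.2 ^ 2 - ‖q.1‖ ^ 2) ξ
      (U ×ˢ Ioo a b)) {s s' : ℝ} (hs0 : 0 < s) (hs : s ∈ Ioo a b) (hs' : s' ∈ Ioo a b)
    (hsδ : s ≤ δ) :
    ∃ φ : E → E, SmoothOnSet φ (ball 0 s ∩ G ⁻¹' U) ∧ ∀ x ∈ ball 0 s ∩ G ⁻¹' U,
      ConeTransports G ξ (x, s) (0, s' - s) (φ x, s') := by
  have : CompleteSpace F := FiniteDimensional.complete ℝ F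
  have hseg : ∀ (y : F) (C : Set F), y ∈ C → ∀ t ∈ Icc (0 : ℝ) 1,
      ((y, s) : F × ℝ) + t • ((0 : F), s' - s) ∈ C ×ˢ uIcc s s' := by
    intro y C hy t ht
    refine ⟨by simpa using hy, ?_⟩
    have := (convex_uIcc s s').add_smul_sub_mem left_mem_uIcc right_mem_uIcc ht
    simpa using this
  have hss : uIcc s s' ⊆ Ioo a b := ordConnected_Ioo.uIcc_subset hs hs'
  have hloc : ∀ y ∈ U, ∃ R > 0, ∃ Ψ : E × ℝ → F × ℝ → E × ℝ,
      ContDiff ℝ ∞ (fun q : (E × ℝ) × (F × ℝ) => Ψ q.1 q.2) ∧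
      ∀ x ∈ ball (0 : E) s, G x ∈ ball y R →
        ConeTransports G ξ (x, s) (0, s' - s) (Ψ (x, s) (0, s' - s)) := by
    intro y hy
    obtain ⟨R, hR, hRU⟩ := nhds_basis_closedBall.mem_iff.1 (hU.mem_nhds hy)
    obtain ⟨Ψ, hΨ, hΨt⟩ := h.exists_transport ((isCompact_closedBall y R).prod isCompact_uIcc)
      (prod_mono hRU hss)
    exact ⟨R, hR, Ψ, hΨ, fun x hx hGx => hΨt _ _ ((mem_ball_iff_coneBound hs0).1 hx).le
      (hseg _ _ (ball_subset_closedBall hGx))⟩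
  choose! R hR Ψ hΨ hΨt using hloc
  have htr : ∀ x ∈ ball 0 s ∩ G ⁻¹' U,
      ConeTransports G ξ (x, s) (0, s' - s) ((Ψ (G x) (x, s) (0, s' - s)).1, s') := by
    intro x hx
    have ht := hΨt (G x) hx.2 x hx.1 (mem_ball_self (hR _ hx.2))
    have h2 : Ψ (G x) (x, s) (0, s' - s) = ((Ψ (G x) (x, s) (0, s' - s)).1, s') :=
      Prod.ext rfl (by simpa using ht.end_eq.2)
    rwa [h2] at ht
  -- Smooth transport is available only over compact sets, so `Ψ` varies with `G x`. By uniqueness,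
  -- near `x₀` the map equals the one given by the single smooth `Ψ (G x₀)`.
  refine ⟨fun x => (Ψ (G x) (x, s) (0, s' - s)).1, fun x₀ hx₀ => ?_, htr⟩
  refine ⟨ball 0 δ ∩ G ⁻¹' ball (G x₀) (R (G x₀)),
    hG.continuousOn.isOpen_inter_preimage isOpen_ball isOpen_ball,
    ⟨ball_subset_ball hsδ hx₀.1, mem_ball_self (hR _ hx₀.2)⟩,
    fun x => (Ψ (G x₀) (x, s) (0, s' - s)).1, ?_, ?_⟩
  · have hin : ContDiff ℝ ∞ (fun x : E => (((x, s) : E × ℝ), ((0, s' - s) : F × ℝ))) := by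
      fun_prop
    exact (contDiff_fst.comp ((hΨ _ hx₀.2).comp hin)).contDiffOn
  · rintro x ⟨⟨-, hx1⟩, hx⟩
    have h1 := hΨt (G x₀) hx₀.2 x hx.1 hx1
    exact (congrArg Prod.fst (h.transports_unique
      (fun t ht => prod_mono_right hss (hseg _ U hx.2 t ht)) h1 (htr x hx))).symm

theorem diffeoOver_ball (hG : ContDiffOn ℝ ∞ G (ball 0 δ)) (hU : IsOpen U)
    (h : IsLiftingField Ω (fun q : E × ℝ => (G q.1, q.2)) (fun q => q.2 ^ 2 - ‖q.1‖ ^ 2) ξ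
      (U ×ˢ Ioo a b)) {s s' : ℝ} (ha : 0 ≤ a) (hs : s ∈ Ioo a b) (hs' : s' ∈ Ioo a b)
    (hsδ : s ≤ δ) (hsδ' : s' ≤ δ) :
    DiffeoOver (ball 0 s ∩ G ⁻¹' U) G (ball 0 s' ∩ G ⁻¹' U) G := by
  have aux : ∀ s ∈ Ioo a b, ∀ s' ∈ Ioo a b, ∀ φ φ' : E → E,
      (∀ x ∈ ball 0 s ∩ G ⁻¹' U, ConeTransports G ξ (x, s) (0, s' - s) (φ x, s')) →
      (∀ x ∈ ball 0 s' ∩ G ⁻¹' U, ConeTransports G ξ (x, s') (0, s - s') (φ' x, s)) →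
      ∀ x ∈ ball 0 s ∩ G ⁻¹' U, φ x ∈ ball 0 s' ∩ G ⁻¹' U ∧ φ' (φ x) = x ∧ G (φ x) = G x := by
    intro s hs s' hs' φ φ' hφ hφ' x hx
    have ht := hφ x hx
    have hGx : G (φ x) = G x := by simpa using ht.end_eq.1
    have hmem : φ x ∈ ball 0 s' ∩ G ⁻¹' U := by
      refine ⟨?_, by rw [mem_preimage, hGx]; exact hx.2⟩
      have := ConeTransports.mem_ball ht (ha.trans_lt hs.1)
        (by linarith [hs'.1] : 0 < s + (s' - s)) hx.1
      simpa using this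
    refine ⟨hmem, ?_, hGx⟩
    have hsy := ht.symm
    have hneg : -((0, s' - s) : F × ℝ) = (0, s - s') := by simp
    rw [hneg] at hsy
    refine congrArg Prod.fst (h.transports_unique (fun t hmt => ?_) (hφ' _ hmem) hsy)
    refine ⟨by simpa using hmem.2, ?_⟩
    have := (convex_Ioo a b).add_smul_sub_mem hs' hs hmt
    simpa using this
  obtain ⟨φ, hφs, hφ⟩ := exists_radial_transport hG hU h (ha.trans_lt hs.1) hs hs' hsδ
  obtain ⟨φ', hφs', hφ'⟩ := exists_radial_transport hG hU h (ha.trans_lt hs'.1) hs' hs hsδ'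
  exact ⟨φ, φ', fun x hx => (aux s hs s' hs' φ φ' hφ hφ' x hx).1,
    fun x hx => (aux s' hs' s hs φ' φ hφ' hφ x hx).1,
    fun x hx => (aux s hs s' hs' φ φ' hφ hφ' x hx).2.1,
    fun x hx => (aux s' hs' s hs φ' φ hφ' hφ x hx).2.1, hφs, hφs',
    fun x hx => (aux s hs s' hs' φ φ' hφ hφ' x hx).2.2⟩

end Trivialization

-- Choice of radii and conclusion.

/-- A nice analytic germ which satisfies the Milnor condition has a Milnor-Hamm fibration. -/
theorem hasMilnorHammFibration {m p : ℕ}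
    {G : EuclideanSpace ℝ (Fin m) → EuclideanSpace ℝ (Fin p)} (hG : AnalyticAt ℝ G 0)
    (hnice : IsNice G) (hM : MilnorCondition G) : HasMilnorHammFibration G := by
  obtain ⟨δ, hδ, hGδ, hreg⟩ := exists_regular_radius hG hnice hM
  have key : ∀ r ∈ Ioo 0 δ, ∀ a > 0, ∀ b ∈ Ioo 0 δ, ∃ η₀ > 0, ∀ η ≤ η₀,
      IsLiftingField (coneDomain G δ) (fun q : EuclideanSpace ℝ (Fin m) × ℝ => (G q.1, q.2))
        (fun q => q.2 ^ 2 - ‖q.1‖ ^ 2) (coneLift G) ((ball 0 η \ disc G r) ×ˢ Ioo a b) := by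
    intro r hr a ha b hb
    obtain ⟨η₀, hη₀, h⟩ := hreg r hr a ha b hb
    refine ⟨η₀, hη₀, fun η hη => isLiftingField_coneLift hGδ
      (fun y hy => ⟨ha.trans hy.2.1, hy.2.2.trans hb.2⟩) fun x s hx hxs => ?_⟩
    obtain ⟨h1, h2⟩ := h x (hx.trans hxs.2.2.le)
      (sdiff_subset_sdiff_left (ball_subset_ball hη) hxs.1)
    exact ⟨h1, fun he => h2 (he ▸ hxs.2.1.le)⟩
  have hopen : ∀ η r, IsOpen (ball (0 : EuclideanSpace ℝ (Fin p)) η \ disc G r) := fun η r =>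
    isOpen_ball.sdiff (isClosed_disc r)
  refine ⟨δ, hδ, fun r hr ε hε => ?_⟩
  -- The open interval of radii must contain `ε`, and also `ε'` in the second part; its lower end is
  -- `ε / 2` or `ε' / 2` accordingly.
  have hb : (ε + δ) / 2 ∈ Ioo 0 δ := ⟨by linarith [hε.1], by linarith [hε.2]⟩
  have hεb : ε < (ε + δ) / 2 := by linarith [hε.2]
  refine ⟨?_, fun ε' hε' => ?_⟩
  · obtain ⟨η₀, hη₀, h⟩ := key r hr (ε / 2) (half_pos hε.1) _ hb
    refine ⟨min η₀ (ε / 2), ⟨lt_min hη₀ (half_pos hε.1),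
      (min_le_right _ _).trans_lt (half_lt_self hε.1)⟩, fun η hη y hy => ?_⟩
    exact isLocallyTrivialOver_connectedComponentIn (fun z hz =>
      exists_trivialization_ball hGδ (hopen η r) (h η (hη.2.trans (min_le_left _ _))) hε.1
        ⟨half_lt_self hε.1, hεb⟩ hε.2.le hz) hy
  · obtain ⟨η₁, hη₁, h⟩ := key r hr (ε' / 2) (half_pos hε'.1) _ hb
    exact ⟨η₁, hη₁, fun η hη => diffeoOver_ball hGδ (hopen η r) (h η hη.2) (half_pos hε'.1).le
      ⟨by linarith [hε'.1, hε'.2], hεb⟩ ⟨half_lt_self hε'.1, hε'.2.trans hεb⟩ hε.2.le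
      (hε'.2.trans hε.2).le⟩

end MilnorHamm

theorem lemma3p3 (m p : ℕ) (hp : 0 < p) (hmp : p < m)
    (G : EuclideanSpace ℝ (Fin m) → EuclideanSpace ℝ (Fin p))
    (hG : AnalyticAt ℝ G 0) (hG0 : G 0 = 0)
    (hconst : ¬ ∀ᶠ x in 𝓝 (0 : EuclideanSpace ℝ (Fin m)), G x = 0)
    (hnice : MilnorHamm.IsNice G) (hM : MilnorHamm.MilnorCondition G) :
    MilnorHamm.HasMilnorHammFibration G := by
  exact MilnorHamm.hasMilnorHammFibration hG hnice hM
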